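/- A *virtual knot diagram* is a smooth oriented immersion of the circle in the plane whose only multiple points are transverse double points, each of which is either classical (with over/under information) or virtual. A *virtual knot* is an equivalence class of such diagrams under planar isotopy, the Reidemeister moves and the detour move; equivalently, it is an equivalence class of Gauss diagrams (Gauss codes up to basepoint and labelling) under the Reidemeister moves. A virtual knot $K$ is *almost classical* if it has a diagram whose short arcs (the arcs from one passage through a classical crossing to the next) can be numbered by integers so that, at every classical crossing of sign $\varepsilon=\pm1$, the incoming under-arc and the outgoing over-arc carry the same number $m$, while the outgoing under-arc and the incoming over-arc carry the number $m+\varepsilon$. $K$ is *periodic with period $q$* if it has a diagram which misses the origin and is invariant under the rotation of the plane by $2\pi/q$ about the origin. For a diagram of $K$ with $n$ classical crossings and long arcs $x_1,\dots,x_n$ (indices modulo $n$), numbered so that at the $i$-th crossing, of sign $\varepsilon_i$, $x_i$ is the incoming under-arc, $x_{i+1}$ the outgoing under-arc and $x_k$ the over-arc, the Wirtinger relations are $x_k^{-\varepsilon_i}x_ix_k^{\varepsilon_i}x_{i+1}^{-1}$. Let $A$ be the $n\times n$ matrix of their Fox derivatives, with every $x_j$ replaced by $t$: its $i$-th row has $t^{-\varepsilon_i}$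 in column $i$, $-1$ in column $i+1$ and $1-t^{-\varepsilon_i}$ in column $k$ (added up if columns coincide), and $0$ elsewhere. The *Alexander polynomial* $\Delta_K\in\mathbb Z[t^{\pm1}]$ is the greatest common divisor of the $(n-1)\times(n-1)$ minors of $A$ (it is $1$ if $n=0$), i.e. the generator, unique up to units $\pm t^j$, of the smallest principal ideal containing the first elementary ideal of $K$. It is *trivial* if it is a unit of $\mathbb Z[t^{\pm1}]$. The *span* of a nonzero Laurent polynomial is the difference between the largest and the smallest exponent occurring in it. **Theorem.** Let $K$ be an almost classical knot such that $\Delta_K$ is not trivial. If $K$ has prime period $p$, then $p$ divides a nonzero coefficient of $\Delta_K$, or $\operatorname{span}(\Delta_K)\ge p-1$. In particular, there are at most finitely many primes $p$ for which $K$ has period $p$. -/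

import Mathlib

open scoped LaurentPolynomial ContDiff

noncomputable section

/-! ### Gauss codes and virtual knots -/

/-- A letter of a Gauss code: the label of a classical crossing, whether the crossing is met along
its over-strand (`isOver = true`) or along its under-strand (`isOver = false`), and its sign. -/
@[ext]
structure GaussLetter where
  label : ℕ
  isOver : Bool
  sign : ℤˣ
deriving DecidableEq

namespace GaussLetter

/-- The other passage through the same crossing. -/
def partner (a : GaussLetter) : GaussLetter := ⟨a.label, !a.isOver, a.sign⟩

/-- Renumbering of crossings. -/
def relabel (f : Equiv.Perm ℕ) (a : GaussLetter) : GaussLetter := ⟨f a.label, a.isOver, a.sign⟩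

end GaussLetter

/-- The Gauss code of an oriented knot diagram, read from a basepoint: each crossing that occurs
is met exactly twice, once over and once under, with the same sign.  The same data, up to the choice
of basepoint and labels, is a Gauss diagram: the positions of the word are the chord endpoints on
the base circle. -/
structure GaussCode where
  word : List GaussLetter
  nodup : word.Nodup
  partner_mem : ∀ a ∈ word, a.partner ∈ word
  sign_eq : ∀ a ∈ word, ∀ b ∈ word, a.label = b.label → a.sign = b.sign

/-- The two-letter word `ab` or `ba`, according to a sign. -/
def orderedPair (s : ℤˣ) (a b : GaussLetter) : List GaussLetter :=
  if s = 1 then [a, b] else [b, a]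

/-- The elementary moves on Gauss words: change of basepoint, renumbering of crossings, and the
three oriented Reidemeister moves.  (Virtual crossings do not appear in a Gauss code, so planar
isotopy, the detour move and the purely virtual moves act trivially.) -/
inductive GaussMove : List GaussLetter → List GaussLetter → Prop
  | basepoint (u v : List GaussLetter) : GaussMove (u ++ v) (v ++ u)
  | renumber (f : Equiv.Perm ℕ) (w : List GaussLetter) :
      GaussMove w (w.map (GaussLetter.relabel f))
  /-- A curl with an arbitrary sign, met over first or under first. -/
  | reidemeister1 (a : GaussLetter) (w : List GaussLetter) :
      GaussMove ([a, a.partner] ++ w) w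
  /-- Two consecutive over-passages of one strand across another one, with opposite signs;
  `s` tells whether the two strands run in parallel or in antiparallel directions. -/
  | reidemeister2 (i j : ℕ) (e s : ℤˣ) (u v : List GaussLetter) :
      GaussMove
        ([⟨i, true, e⟩, ⟨j, true, -e⟩] ++ u ++ orderedPair s ⟨i, false, e⟩ ⟨j, false, -e⟩ ++ v)
        (u ++ v)
  /-- Three strands, top, middle and bottom, crossing each other in `i` (top over middle), `j` (top
  over bottom) and `k` (middle over bottom), with signs `x`, `y`, `z`.  The move reverses the order
  of the two crossings on each strand.  For three oriented lines in the plane in general position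
  the three orders are related to the signs as displayed, with `d` the side of the triangle. Here
  the middle strand is met after the top one and before the bottom one. -/
  | reidemeister3 (i j k : ℕ) (x y z d : ℤˣ) (u v w : List GaussLetter) :
      GaussMove
        (orderedPair (d * y) ⟨i, true, x⟩ ⟨j, true, y⟩ ++ u ++
          orderedPair (d * z) ⟨i, false, x⟩ ⟨k, true, z⟩ ++ v ++
          orderedPair (d * x * y * z) ⟨j, false, y⟩ ⟨k, false, z⟩ ++ w)
        (orderedPair (-d * y) ⟨i, true, x⟩ ⟨j, true, y⟩ ++ u ++
          orderedPair (-d * z) ⟨i, false, x⟩ ⟨k, true, z⟩ ++ v ++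
          orderedPair (-d * x * y * z) ⟨j, false, y⟩ ⟨k, false, z⟩ ++ w)
  /-- The same move when the bottom strand is met after the top one and before the middle one. -/
  | reidemeister3' (i j k : ℕ) (x y z d : ℤˣ) (u v w : List GaussLetter) :
      GaussMove
        (orderedPair (d * y) ⟨i, true, x⟩ ⟨j, true, y⟩ ++ u ++
          orderedPair (d * x * y * z) ⟨j, false, y⟩ ⟨k, false, z⟩ ++ v ++
          orderedPair (d * z) ⟨i, false, x⟩ ⟨k, true, z⟩ ++ w)
        (orderedPair (-d * y) ⟨i, true, x⟩ ⟨j, true, y⟩ ++ u ++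
          orderedPair (-d * x * y * z) ⟨j, false, y⟩ ⟨k, false, z⟩ ++ v ++
          orderedPair (-d * z) ⟨i, false, x⟩ ⟨k, true, z⟩ ++ w)

/-- An (oriented) virtual knot: a Gauss code up to the equivalence relation generated by the
elementary moves. -/
def VirtualKnot : Type := Quot fun D D' : GaussCode => GaussMove D.word D'.word

/-- The virtual knot represented by a Gauss code. -/
def GaussCode.knot (D : GaussCode) : VirtualKnot := Quot.mk _ D

/-! ### Almost classical knots -/

/-- A Gauss code is Alexander numberable if the short arcs (from one passage through a classical
crossing to the next passage) can be numbered by integers such that at each crossing of sign `ε`,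
the incoming under-arc and the outgoing over-arc have the same number `m`, and the outgoing
under-arc and the incoming over-arc have the same number `m + ε`.  Here `num a` is the number of the
short arc that ends at the letter `a`. -/
def GaussCode.IsAlexanderNumberable (D : GaussCode) : Prop :=
  ∃ num : GaussLetter → ℤ, ∀ (a : GaussLetter) (ha : a ∈ D.word), a.isOver = false →
    num (D.word.next a.partner (D.partner_mem a ha)) = num a ∧
    num (D.word.next a ha) = num a.partner ∧
    num a.partner = num a + (a.sign : ℤ)

/-- A virtual knot is almost classical if some diagram of it is Alexander numberable. -/
def VirtualKnot.IsAlmostClassical (K : VirtualKnot) : Prop :=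
  ∃ D : GaussCode, D.knot = K ∧ D.IsAlexanderNumberable

/-! ### The Alexander polynomial -/

namespace GaussCode

/-- The under-passages of a Gauss code.  They index the classical crossings, and also the long arcs:
the long arc with index `a` is the one that ends at the under-passage `a`. -/
abbrev Under (D : GaussCode) : Type :=
  {a : GaussLetter // a ∈ D.word.toFinset.filter fun a => a.isOver = false}

/-- The first under-passage that follows the letter `a` in cyclic order (possibly `a` itself, after
one full turn).  It ends the long arc which contains the short arc leaving `a`. -/
def nextUnder (D : GaussCode) (a : GaussLetter) : Option GaussLetter :=
  (D.word.rotate (D.word.idxOf a + 1)).find? fun b => !b.isOver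

/-- The Jacobian matrix of the Wirtinger presentation.  The crossing `a` of sign `ε`, with incoming
under-arc `x_i`, outgoing under-arc `x_{i+1}` and over-arc `x_k`, gives the relation
`x_k^{-ε} x_i x_k^ε x_{i+1}⁻¹`, whose Fox derivatives, after all generators are sent to `t`, are
`t^{-ε}` for `x_i`, `-1` for `x_{i+1}` and `1 - t^{-ε}` for `x_k`; contributions add up when some of
these arcs coincide. -/
def jacobian (D : GaussCode) : Matrix D.Under D.Under ℤ[T;T⁻¹] := fun a b =>
  (if b = a then LaurentPolynomial.T (-(a.1.sign : ℤ)) else 0)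
    + (if D.nextUnder a.1 = some b.1 then -1 else 0)
    + (if D.nextUnder a.1.partner = some b.1 then
        1 - LaurentPolynomial.T (-(a.1.sign : ℤ)) else 0)

/-- The first elementary ideal: the ideal generated by the `(n - 1) × (n - 1)` minors of the
`n × n` Jacobian matrix.  (Choices with repeated rows or columns only add zeros; for `n = 0` the
knot group is infinite cyclic, and the ideal is the unit ideal.) -/
def firstElementaryIdeal (D : GaussCode) : Ideal ℤ[T;T⁻¹] :=
  Ideal.span {m | ∃ r c : Fin (Fintype.card D.Under - 1) → D.Under,
    m = (D.jacobian.submatrix r c).det}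

end GaussCode

/-- `Δ` is an Alexander polynomial of the virtual knot `K` (it is determined up to units): for a
diagram of `K`, `Δ` generates the smallest principal ideal that contains the first elementary
ideal. -/
def VirtualKnot.IsAlexanderPolynomial (K : VirtualKnot) (Δ : ℤ[T;T⁻¹]) : Prop :=
  ∃ D : GaussCode, D.knot = K ∧ D.firstElementaryIdeal ≤ Ideal.span {Δ} ∧
    ∀ g : ℤ[T;T⁻¹], D.firstElementaryIdeal ≤ Ideal.span {g} → Ideal.span {Δ} ≤ Ideal.span {g}

/-- The span of a Laurent polynomial: the difference between the largest and the smallest exponent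
that occur in it (`0` for the zero polynomial). -/
def laurentSpan (f : ℤ[T;T⁻¹]) : ℤ :=
  if h : f.coeff.support.Nonempty then f.coeff.support.max' h - f.coeff.support.min' h else 0

/-! ### Planar virtual knot diagrams and periodicity -/

/-- Two real parameters that give the same point of the circle `ℝ / ℤ`. -/
def SameParam (s t : ℝ) : Prop := ∃ n : ℤ, t = s + n

/-- The cross product of two plane vectors. -/
def planeCross (v w : ℂ) : ℝ := v.re * w.im - v.im * w.re

/-- An oriented virtual knot diagram in the plane `ℂ`: a smooth immersion of the circle `ℝ / ℤ`
whose only multiple points are transverse double points, some of which are classical crossings.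
`crossesOver s t` means that the points with parameters `s` and `t` form a classical crossing in which the
strand through `s` is the over-strand.  The other double points are the virtual crossings. -/
structure VirtualDiagram where
  curve : ℝ → ℂ
  crossesOver : ℝ → ℝ → Prop
  smooth : ContDiff ℝ ∞ curve
  periodic : ∀ s, curve (s + 1) = curve s
  immersion : ∀ s, deriv curve s ≠ 0
  no_triple : ∀ s t u, curve s = curve t → curve s = curve u →
    SameParam s t ∨ SameParam s u ∨ SameParam t u
  transverse : ∀ s t, curve s = curve t → ¬ SameParam s t →
    planeCross (deriv curve s) (deriv curve t) ≠ 0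
  over_double : ∀ s t, crossesOver s t → curve s = curve t ∧ ¬ SameParam s t
  over_asymm : ∀ s t, crossesOver s t → ¬ crossesOver t s
  over_periodic : ∀ s t s' t', SameParam s s' → SameParam t t' → crossesOver s t → crossesOver s' t'

namespace VirtualDiagram

/-- `D` is the Gauss code of the planar diagram `P`, read from the basepoint `0 ∈ ℝ / ℤ`: the
letters correspond, in order, to the parameters `s ∈ [0, 1)` at which `P` passes through a classical
crossing.  A crossing is positive (right-handed) if the under-strand crosses the over-strand from
right to left. -/
def HasGaussCode (P : VirtualDiagram) (D : GaussCode) : Prop :=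
  ∃ s : Fin D.word.length → ℝ, StrictMono s ∧ (∀ i, s i ∈ Set.Ico (0 : ℝ) 1) ∧
    (∀ x ∈ Set.Ico (0 : ℝ) 1, (∃ y, P.crossesOver x y ∨ P.crossesOver y x) → ∃ i, s i = x) ∧
    (∀ i j, P.crossesOver (s i) (s j) ↔
      (D.word.get i).isOver = true ∧ (D.word.get j).isOver = false ∧
        (D.word.get i).label = (D.word.get j).label) ∧
    (∀ i j, P.crossesOver (s i) (s j) →
      0 < (((D.word.get i).sign : ℤ) : ℝ) *
        planeCross (deriv P.curve (s i)) (deriv P.curve (s j)))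

/-- The diagram misses the origin. -/
def MissesOrigin (P : VirtualDiagram) : Prop := ∀ s, P.curve s ≠ 0

/-- The diagram is invariant under the rotation by the angle `2 π / q` about the origin: the rotated
diagram is the same oriented diagram up to a reparametrisation of the circle, with the same
classical crossings, over- and under-strands included.  `φ` is the lift of the reparametrisation
to `ℝ`. -/
def IsRotationInvariant (P : VirtualDiagram) (q : ℕ) : Prop :=
  ∃ φ : ℝ ≃o ℝ, (∀ s, φ (s + 1) = φ s + 1) ∧
    (∀ s, Complex.exp (2 * Real.pi * Complex.I / q) * P.curve s = P.curve (φ s)) ∧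
    (∀ s t, P.crossesOver s t ↔ P.crossesOver (φ s) (φ t))

end VirtualDiagram

/-- A virtual knot is periodic with period `q` if it admits a planar virtual knot diagram which
misses the origin and is invariant under the rotation by `2 π / q` about the origin. -/
def VirtualKnot.HasPeriod (K : VirtualKnot) (q : ℕ) : Prop :=
  ∃ (P : VirtualDiagram) (D : GaussCode), P.HasGaussCode D ∧ D.knot = K ∧
    P.MissesOrigin ∧ P.IsRotationInvariant q

end

/-! The first elementary ideal is a knot invariant, and this lets two different diagrams of `K`
cooperate. In an Alexander numberable diagram with crossings, the rows of the Jacobian are linearly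
dependent with coefficients that are powers of `T`, hence units, while every row sums to zero. All
codimension one minors are therefore multiples of a single one and the ideal is principal. By
invariance, the ideal of the periodic diagram, which need not be numberable, is then exactly the
ideal generated by `Δ`.

For invariance, the ideal of minors is replaced by the ideal of entries of the adjugate. The
adjugate is multiplicative, so this ideal depends only on the module presented by the square matrix
(`IsPresentation.adjugateIdeal_eq`). The Jacobian presents the Alexander module, the universal
target of colourings of the Gauss word, and each Reidemeister move induces an isomorphism of these
modules (`equiv_of_move`).

The rotation acts on the crossings of the periodic diagram as a free permutation of order `p` that
preserves the Jacobian, so the Jacobian is block circulant. Modulo `p` the group algebra of the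
cyclic group of order `p` is truncated polynomial in the nilpotent element `g - 1`, where `g` is a
generator. In the corresponding binomial basis the matrix becomes block Toeplitz and upper
triangular, and its diagonal block has vanishing row sums. Replacing and shifting one column in each
block exhibits a determinant `d` such that `d ^ (p - 1)` divides every codimension one minor and `d
^ p` lies in their ideal. Thus `d ^ (p - 1) ∣ Δ ∣ d ^ p` modulo `p`.

If `p` divides no nonzero coefficient, `Δ` keeps its span modulo `p`. A nonconstant extent of `d`
then forces span at least `p - 1`. If `d` has span zero, `Δ` has span zero as well. Since the value
of `Δ` at one is a unit of `ℤ`, it would then be a unit, contrary to assumption. -/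

/-! ### The ideal of the entries of the adjugate -/

namespace Matrix

section AdjugateIdeal

variable {R : Type*} [CommRing R] {ι κ : Type*} [Fintype ι] [DecidableEq ι]
  [Fintype κ] [DecidableEq κ]

/-- The ideal generated by the entries of the adjugate matrix. -/
def adjugateIdeal (A : Matrix ι ι R) : Ideal R :=
  Ideal.span (Set.range fun x : ι × ι => A.adjugate x.1 x.2)

theorem adjugate_mem_adjugateIdeal (A : Matrix ι ι R) (i j : ι) :
    A.adjugate i j ∈ A.adjugateIdeal :=
  Ideal.subset_span ⟨(i, j), rfl⟩

theorem adjugateIdeal_le_iff {A : Matrix ι ι R} {I : Ideal R} :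
    A.adjugateIdeal ≤ I ↔ ∀ i j, A.adjugate i j ∈ I := by
  unfold adjugateIdeal
  rw [Ideal.span_le]
  constructor
  · intro h i j
    exact h ⟨(i, j), rfl⟩
  · rintro h _ ⟨⟨i, j⟩, rfl⟩
    exact h i j

/-- Multiplicativity of the adjugate is the reason for working with this ideal: row and column
operations over the ring, and comparisons of presentations, become inclusions. -/
theorem adjugateIdeal_mul_le_left (A B : Matrix ι ι R) :
    (A * B).adjugateIdeal ≤ A.adjugateIdeal := by
  rw [adjugateIdeal_le_iff]
  intro i j
  rw [adjugate_mul_distrib, mul_apply]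
  exact Ideal.sum_mem _ fun k _ => Ideal.mul_mem_left _ _ (adjugate_mem_adjugateIdeal A k j)

theorem adjugateIdeal_mul_le_right (A B : Matrix ι ι R) :
    (A * B).adjugateIdeal ≤ B.adjugateIdeal := by
  rw [adjugateIdeal_le_iff]
  intro i j
  rw [adjugate_mul_distrib, mul_apply]
  exact Ideal.sum_mem _ fun k _ => Ideal.mul_mem_right _ _ (adjugate_mem_adjugateIdeal B i k)

theorem adjugateIdeal_mul_of_isUnit_det_right (A : Matrix ι ι R) {P : Matrix ι ι R}
    (hP : IsUnit P.det) : (A * P).adjugateIdeal = A.adjugateIdeal := by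
  refine le_antisymm (adjugateIdeal_mul_le_left A P) ?_
  conv_lhs => rw [← mul_nonsing_inv_cancel_right P A hP]
  exact adjugateIdeal_mul_le_left _ _

theorem adjugateIdeal_mul_of_isUnit_det_left (A : Matrix ι ι R) {P : Matrix ι ι R}
    (hP : IsUnit P.det) : (P * A).adjugateIdeal = A.adjugateIdeal := by
  refine le_antisymm (adjugateIdeal_mul_le_right P A) ?_
  conv_lhs => rw [← nonsing_inv_mul_cancel_left P A hP]
  exact adjugateIdeal_mul_le_right _ _

theorem adjugateIdeal_submatrix_equiv (A : Matrix ι ι R) (e : κ ≃ ι) :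
    (A.submatrix e e).adjugateIdeal = A.adjugateIdeal := by
  apply le_antisymm
  · rw [adjugateIdeal_le_iff]
    intro i j
    rw [adjugate_submatrix_equiv_self]
    exact adjugate_mem_adjugateIdeal A _ _
  · rw [adjugateIdeal_le_iff]
    intro i j
    have := adjugate_mem_adjugateIdeal (A.submatrix e e) (e.symm i) (e.symm j)
    rw [adjugate_submatrix_equiv_self] at this
    simpa using this

theorem adjugateIdeal_map {S : Type*} [CommRing S] (f : R →+* S) (A : Matrix ι ι R) :
    (A.map f).adjugateIdeal = A.adjugateIdeal.map f := by
  unfold adjugateIdeal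
  rw [Ideal.map_span, ← Set.range_comp]
  congr 2
  ext x
  have := congrFun (congrFun (f.map_adjugate A) x.1) x.2
  simpa using this.symm

theorem det_mem_adjugateIdeal [Nonempty ι] (A : Matrix ι ι R) : A.det ∈ A.adjugateIdeal := by
  obtain ⟨i⟩ := ‹Nonempty ι›
  rw [det_eq_sum_mul_adjugate_row A i]
  exact Ideal.sum_mem _ fun j _ => Ideal.mul_mem_left _ _ (adjugate_mem_adjugateIdeal A j i)

theorem adjugateIdeal_of_unique [Unique ι] (A : Matrix ι ι R) : A.adjugateIdeal = ⊤ := by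
  rw [Ideal.eq_top_iff_one]
  have := adjugate_mem_adjugateIdeal A default default
  rwa [adjugate_subsingleton, one_apply_eq] at this

/-- Both sides invert the block matrix up to the factor `B.det`, which may be cancelled when it is
regular. -/
theorem adjugate_fromBlocks_one_of_isLeftRegular (B : Matrix ι ι R) (hB : IsLeftRegular B.det) :
    (fromBlocks B 0 0 (1 : Matrix κ κ R)).adjugate
      = fromBlocks B.adjugate 0 0 (B.det • (1 : Matrix κ κ R)) := by
  set M := fromBlocks B 0 0 (1 : Matrix κ κ R) with hM
  have hdet : M.det = B.det := by simp [hM]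
  have h1 : fromBlocks B.adjugate 0 0 (B.det • (1 : Matrix κ κ R)) * M
      = B.det • (1 : Matrix (ι ⊕ κ) (ι ⊕ κ) R) := by
    rw [hM, fromBlocks_multiply]
    simp [adjugate_mul, ← fromBlocks_one, fromBlocks_smul]
  have h2 : M * M.adjugate = B.det • (1 : Matrix (ι ⊕ κ) (ι ⊕ κ) R) := by
    rw [mul_adjugate, hdet]
  have h3 : B.det • M.adjugate
      = B.det • fromBlocks B.adjugate 0 0 (B.det • (1 : Matrix κ κ R)) := by
    calc B.det • M.adjugate = (B.det • (1 : Matrix (ι ⊕ κ) (ι ⊕ κ) R)) * M.adjugate := by simp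
      _ = fromBlocks B.adjugate 0 0 (B.det • (1 : Matrix κ κ R)) * (M * M.adjugate) := by
        rw [← h1, Matrix.mul_assoc]
      _ = _ := by rw [h2]; simp
  ext i j
  exact hB (by simpa using congrFun (congrFun h3 i) j)

/-- The identity is polynomial in the entries, so it suffices to prove it for `A + X • 1`, whose
determinant is monic and hence regular, and to specialise at `X = 0`. -/
theorem adjugate_fromBlocks_one (A : Matrix ι ι R) :
    (fromBlocks A 0 0 (1 : Matrix κ κ R)).adjugate
      = fromBlocks A.adjugate 0 0 (A.det • (1 : Matrix κ κ R)) := by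
  have hreg : IsLeftRegular (det (A.map Polynomial.C +
      (Polynomial.X : Polynomial R) • (1 : Matrix ι ι (Polynomial R)))) := by
    refine (Polynomial.Monic.isRegular ?_).left
    rw [Polynomial.Monic.def, ← Polynomial.leadingCoeff_det_X_one_add_C A, add_comm]
  have h := adjugate_fromBlocks_one_of_isLeftRegular (κ := κ) _ hreg
  have hmap : ((A.map Polynomial.C + (Polynomial.X : Polynomial R) • 1).map
      (Polynomial.evalRingHom (0 : R))) = A := by
    ext i j
    simp [Matrix.one_apply, apply_ite]
  have hbl : (fromBlocks (A.map Polynomial.C + (Polynomial.X : Polynomial R) • 1) 0 0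
      (1 : Matrix κ κ (Polynomial R))).map (Polynomial.evalRingHom (0 : R))
      = fromBlocks A 0 0 (1 : Matrix κ κ R) := by
    rw [fromBlocks_map, hmap]
    simp
  have hl := (Polynomial.evalRingHom (0 : R)).map_adjugate
    (fromBlocks (A.map Polynomial.C + (Polynomial.X : Polynomial R) • 1) 0 0
      (1 : Matrix κ κ (Polynomial R)))
  rw [RingHom.mapMatrix_apply, RingHom.mapMatrix_apply, hbl] at hl
  rw [← hl, h, fromBlocks_map]
  have ha := (Polynomial.evalRingHom (0 : R)).map_adjugate
    (A.map Polynomial.C + (Polynomial.X : Polynomial R) • 1)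
  have hd := (Polynomial.evalRingHom (0 : R)).map_det
    (A.map Polynomial.C + (Polynomial.X : Polynomial R) • 1)
  rw [RingHom.mapMatrix_apply, hmap] at hd
  rw [RingHom.mapMatrix_apply, RingHom.mapMatrix_apply, hmap] at ha
  congr 1
  · simp
  · simp
  · ext i j
    rw [map_apply, smul_apply, smul_eq_mul, map_mul, hd, smul_apply, smul_eq_mul]
    rcases eq_or_ne i j with rfl | hij
    · simp
    · simp [hij]

/-- This is the effect of adjoining redundant generators to a presentation. The only new minors are
multiples of `A.det`, which already lies in the ideal by expansion along a row; this needs `ι`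
nonempty. -/
theorem adjugateIdeal_fromBlocks [Nonempty ι] (A : Matrix ι ι R) (Y : Matrix κ ι R) :
    (fromBlocks A 0 Y (1 : Matrix κ κ R)).adjugateIdeal = A.adjugateIdeal := by
  have h : fromBlocks A 0 Y (1 : Matrix κ κ R)
      = fromBlocks A 0 0 (1 : Matrix κ κ R) * fromBlocks (1 : Matrix ι ι R) 0 Y 1 := by
    rw [fromBlocks_multiply]
    simp
  rw [h, adjugateIdeal_mul_of_isUnit_det_right _ (by simp)]
  apply le_antisymm
  · rw [adjugateIdeal_le_iff, adjugate_fromBlocks_one]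
    rintro (i | i) (j | j)
    · exact adjugate_mem_adjugateIdeal A i j
    · simp
    · simp
    · exact Ideal.mul_mem_right _ _ (det_mem_adjugateIdeal A)
  · rw [adjugateIdeal_le_iff]
    intro i j
    have := adjugate_mem_adjugateIdeal (fromBlocks A 0 0 (1 : Matrix κ κ R)) (Sum.inl i) (Sum.inl j)
    rwa [adjugate_fromBlocks_one] at this

/-- A selection with repetitions has determinant zero. An injective one omits a single index, so it
is some `succAbove` followed by a permutation, and the minor is a cofactor up to sign. -/
theorem det_submatrix_mem_span_adjugate {n : ℕ} (A : Matrix (Fin (n + 1)) (Fin (n + 1)) R)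
    (r c : Fin n → Fin (n + 1)) : (A.submatrix r c).det ∈ A.adjugateIdeal := by
  have key : ∀ r : Fin n → Fin (n + 1), Function.Injective r →
      ∃ (i : Fin (n + 1)) (σ : Equiv.Perm (Fin n)), r = i.succAbove ∘ σ := by
    intro r hr
    obtain ⟨i, hi⟩ : ∃ i, i ∉ Set.range r := by
      by_contra! h
      have := Fintype.card_le_of_surjective r h
      simp at this
    have : ∀ x, ∃ y, i.succAbove y = r x := fun x =>
      Fin.exists_succAbove_eq fun hx => hi ⟨x, hx⟩
    choose f hf using this
    have hf' : Function.Injective f := fun x y hxy => hr (by rw [← hf, ← hf, hxy])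
    exact ⟨i, Equiv.ofBijective f (Finite.injective_iff_bijective.1 hf'), by
      ext x; simp [hf]⟩
  by_cases hr : Function.Injective r
  swap
  · obtain ⟨x, y, hxy, hne⟩ : ∃ x y, r x = r y ∧ x ≠ y := by
      simpa [Function.Injective] using hr
    rw [det_zero_of_row_eq hne (by ext; simp [hxy])]
    exact Ideal.zero_mem _
  by_cases hc : Function.Injective c
  swap
  · obtain ⟨x, y, hxy, hne⟩ : ∃ x y, c x = c y ∧ x ≠ y := by
      simpa [Function.Injective] using hc
    rw [det_zero_of_column_eq hne (by intro; simp [hxy])]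
    exact Ideal.zero_mem _
  obtain ⟨i, σ, rfl⟩ := key r hr
  obtain ⟨j, τ, rfl⟩ := key c hc
  have h1 : A.submatrix (i.succAbove ∘ σ) (j.succAbove ∘ τ)
      = ((A.submatrix i.succAbove j.succAbove).submatrix σ id).submatrix id τ := rfl
  rw [h1, det_permute', det_permute]
  have h2 := adjugate_mem_adjugateIdeal A j i
  rw [adjugate_fin_succ_eq_det_submatrix] at h2
  have h3 := Ideal.mul_mem_left _ ((-1) ^ (i + j : ℕ)) h2
  rw [← mul_assoc, ← pow_add, ← two_mul, pow_mul, neg_one_sq, one_pow, one_mul] at h3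
  exact Ideal.mul_mem_left _ _ (Ideal.mul_mem_left _ _ h3)

theorem span_det_submatrix_eq_adjugateIdeal [Nonempty ι] (A : Matrix ι ι R) :
    Ideal.span {m | ∃ r c : Fin (Fintype.card ι - 1) → ι, m = (A.submatrix r c).det}
      = A.adjugateIdeal := by
  obtain ⟨n, hn⟩ : ∃ n, Fintype.card ι = n + 1 :=
    Nat.exists_eq_succ_of_ne_zero Fintype.card_ne_zero
  have hn' : Fintype.card ι - 1 = n := by omega
  rw [hn']
  let e : Fin (n + 1) ≃ ι := (Fintype.equivFinOfCardEq hn).symm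
  rw [← adjugateIdeal_submatrix_equiv A e]
  apply le_antisymm
  · rw [Ideal.span_le]
    rintro _ ⟨r, c, rfl⟩
    have := det_submatrix_mem_span_adjugate (A.submatrix e e) (e.symm ∘ r) (e.symm ∘ c)
    rw [submatrix_submatrix, ← Function.comp_assoc, ← Function.comp_assoc] at this
    simpa using this
  · rw [adjugateIdeal_le_iff]
    intro i j
    rw [adjugate_fin_succ_eq_det_submatrix]
    refine Ideal.mul_mem_left _ _ (Ideal.subset_span ⟨e ∘ j.succAbove, e ∘ i.succAbove, ?_⟩)
    rfl

end AdjugateIdeal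

section Principal

variable {R : Type*} [CommRing R] {ι : Type*} [Fintype ι] [DecidableEq ι]

theorem det_one_updateCol (i : ι) (v : ι → R) : ((1 : Matrix ι ι R).updateCol i v).det = v i := by
  rw [← cramer_apply, cramer_one]
  rfl

theorem det_one_updateRow (i : ι) (v : ι → R) : ((1 : Matrix ι ι R).updateRow i v).det = v i := by
  rw [← det_transpose, ← updateCol_transpose, transpose_one, det_one_updateCol]

/-- A matrix with vanishing row sums and a dependency with unit coefficients between its rows has
a principal ideal of codimension one minors. -/
theorem exists_adjugateIdeal_eq_span_singleton [Nonempty ι] {A : Matrix ι ι R} {u : ι → R}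
    (hu : ∀ i, IsUnit (u i)) (hA : u ᵥ* A = 0) (h1 : A *ᵥ 1 = 0) :
    ∃ g, A.adjugateIdeal = Ideal.span {g} := by
  obtain ⟨i₀⟩ := ‹Nonempty ι›
  -- Multiplying by `P` puts the vanishing combination of the rows in row `i₀`, multiplying by `S`
  -- puts the sum of all columns in column `i₀`. The determinants `u i₀` and `1` are units. With a
  -- zero row and a zero column at `i₀`, only the `(i₀, i₀)` entry of the adjugate can survive.
  set P : Matrix ι ι R := (1 : Matrix ι ι R).updateRow i₀ u with hP
  set S : Matrix ι ι R := (1 : Matrix ι ι R).updateCol i₀ 1 with hS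
  have hrow : ∀ j, (P * A * S) i₀ j = 0 := by
    intro j
    have : ∀ k, (P * A) i₀ k = 0 := by
      intro k
      rw [mul_apply, hP]
      simp only [updateRow_self]
      exact congrFun hA k
    rw [mul_apply]
    simp [this]
  have hcol : ∀ i, (P * A * S) i i₀ = 0 := by
    intro i
    have : ∀ k, (A * S) k i₀ = 0 := by
      intro k
      rw [mul_apply, hS]
      simp only [updateCol_self]
      exact congrFun h1 k
    rw [Matrix.mul_assoc, mul_apply]
    simp [this]
  rw [← adjugateIdeal_mul_of_isUnit_det_left A (P := P) (by rw [hP, det_one_updateRow]; exact hu _),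
    ← adjugateIdeal_mul_of_isUnit_det_right (P * A) (P := S) (by rw [hS, det_one_updateCol]; simp)]
  refine ⟨(P * A * S).adjugate i₀ i₀, le_antisymm ?_ ?_⟩
  · rw [adjugateIdeal_le_iff]
    intro i j
    by_cases hj : j = i₀
    · by_cases hi : i = i₀
      · rw [hi, hj]
        exact Ideal.mem_span_singleton_self _
      · have : (P * A * S).adjugate i j = 0 := by
          rw [adjugate_apply]
          refine det_eq_zero_of_column_eq_zero i₀ fun k => ?_
          rcases eq_or_ne k j with rfl | hk
          · simp [Ne.symm hi]
          · rw [updateRow_ne hk, hcol]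
        rw [this]
        exact Ideal.zero_mem _
    · have : (P * A * S).adjugate i j = 0 := by
        rw [adjugate_apply]
        refine det_eq_zero_of_row_eq_zero i₀ fun k => ?_
        rw [updateRow_ne (Ne.symm hj), hrow]
      rw [this]
      exact Ideal.zero_mem _
  · rw [Ideal.span_singleton_le_iff_mem]
    exact adjugate_mem_adjugateIdeal _ _ _

end Principal

/-! ### Square presentations of modules -/

/-- Only the quotient by the row space has to be tested, with the classes of the standard basis:
there the rows hold tautologically, and `r` holds exactly if it lies in the row space. -/
theorem exists_eq_vecMul_of_forall {R : Type*} [CommRing R] {ι : Type*} [Fintype ι]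
    {A : Matrix ι ι R} {r : ι → R}
    (h : ∀ L : Submodule R (ι → R), ∀ x : ι → (ι → R) ⧸ L,
      (∀ i, ∑ j, A i j • x j = 0) → ∑ j, r j • x j = 0) : ∃ c : ι → R, r = c ᵥ* A := by
  classical
  let L := LinearMap.range (vecMulLinear A)
  let x : ι → (ι → R) ⧸ L := fun b => L.mkQ (Pi.single b 1)
  have hx : ∀ r : ι → R, ∑ b, r b • x b = L.mkQ r := by
    intro r
    simp only [x, ← map_smul, ← map_sum]
    congr 1
    ext b
    simp [Finset.sum_apply, Pi.single_apply]
  have := h L x fun a => by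
    rw [hx]
    refine (Submodule.Quotient.mk_eq_zero L).2 ⟨Pi.single a 1, ?_⟩
    ext b
    simp
  rw [hx] at this
  obtain ⟨c, hc⟩ := (Submodule.Quotient.mk_eq_zero L).1 this
  exact ⟨c, hc.symm⟩

section Presentation

variable {R : Type*} [CommRing R] {M N : Type*} [AddCommGroup M] [Module R M]
  [AddCommGroup N] [Module R N] {ι κ : Type*} [Fintype ι] [Fintype κ]

/-- The square matrix `A` presents the module `M` on the generators `x`: these generate `M`, and
the relations between them are the linear combinations of the rows of `A`. -/
structure IsPresentation (A : Matrix ι ι R) (x : ι → M) : Prop where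
  span_eq_top : Submodule.span R (Set.range x) = ⊤
  relation_iff : ∀ r : ι → R, ∑ i, r i • x i = 0 ↔ ∃ c : ι → R, r = c ᵥ* A

namespace IsPresentation

variable {A : Matrix ι ι R} {x : ι → M} {B : Matrix κ κ R} {y : κ → M}

theorem map (hA : IsPresentation A x) (e : M ≃ₗ[R] N) : IsPresentation A (e ∘ x) where
  span_eq_top := by
    have := Submodule.map_span (e : M →ₗ[R] N) (Set.range x)
    rw [hA.span_eq_top, ← Set.range_comp] at this
    simpa using this.symm
  relation_iff r := by
    rw [← hA.relation_iff]
    have : ∑ i, r i • (e ∘ x) i = e (∑ i, r i • x i) := by simp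
    rw [this, map_eq_zero_iff e e.injective]

theorem submatrix (hA : IsPresentation A x) (e : κ ≃ ι) :
    IsPresentation (A.submatrix e e) (x ∘ e) where
  span_eq_top := by rw [EquivLike.range_comp, hA.span_eq_top]
  relation_iff r := by
    have h1 : ∑ i, r i • (x ∘ e) i = ∑ i, (r ∘ e.symm) i • x i :=
      Fintype.sum_equiv e _ _ (by simp)
    rw [h1, hA.relation_iff]
    constructor
    · rintro ⟨c, hc⟩
      refine ⟨c ∘ e, ?_⟩
      ext j
      have := congrFun hc (e j)
      simp only [Function.comp_apply, Equiv.symm_apply_apply] at this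
      rw [this]
      exact (Fintype.sum_equiv e _ _ (by simp)).symm
    · rintro ⟨c, hc⟩
      refine ⟨c ∘ e.symm, ?_⟩
      ext j
      have := congrFun hc (e.symm j)
      simp only [Function.comp_apply]
      rw [this]
      exact Fintype.sum_equiv e _ _ (by simp)

theorem fromBlocks [DecidableEq κ] (hA : IsPresentation A x) {Y : Matrix κ ι R}
    (hY : ∀ k, y k = ∑ i, Y k i • x i) :
    IsPresentation (Matrix.fromBlocks A 0 (-Y) 1) (Sum.elim x y) where
  span_eq_top := by
    rw [eq_top_iff, ← hA.span_eq_top]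
    apply Submodule.span_mono
    rw [Set.Sum.elim_range]
    exact Set.subset_union_left
  relation_iff r := by
    have h1 : ∑ i, r i • Sum.elim x y i
        = ∑ i, (r ∘ Sum.inl + (r ∘ Sum.inr) ᵥ* Y) i • x i := by
      simp only [Fintype.sum_sum_type, Sum.elim_inl, Sum.elim_inr, hY, Finset.smul_sum,
        Pi.add_apply, add_smul, Finset.sum_add_distrib, Function.comp_apply, vecMul, dotProduct,
        Finset.sum_smul, smul_smul]
      rw [Finset.sum_comm]
    rw [h1, hA.relation_iff]
    constructor
    · rintro ⟨c, hc⟩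
      refine ⟨Sum.elim c (r ∘ Sum.inr), ?_⟩
      rw [vecMul_fromBlocks]
      ext (i | k)
      · simp only [Sum.elim_comp_inl, Sum.elim_comp_inr, Sum.elim_inl, vecMul_neg, ← hc]
        simp
      · simp
    · rintro ⟨c, rfl⟩
      refine ⟨c ∘ Sum.inl, ?_⟩
      rw [vecMul_fromBlocks]
      simp [vecMul_neg]

theorem exists_mul_eq [DecidableEq ι] {A' : Matrix ι ι R} (hA : IsPresentation A x)
    (hA' : IsPresentation A' x) : ∃ C : Matrix ι ι R, A = C * A' := by
  have : ∀ i, ∃ c : ι → R, A i = c ᵥ* A' := fun i => by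
    rw [← hA'.relation_iff, hA.relation_iff]
    exact ⟨Pi.single i 1, by simp; rfl⟩
  choose C hC using this
  refine ⟨C, ?_⟩
  ext i j
  rw [hC i]
  rfl

theorem adjugateIdeal_eq_of_same [DecidableEq ι] {A' : Matrix ι ι R} (hA : IsPresentation A x)
    (hA' : IsPresentation A' x) : A.adjugateIdeal = A'.adjugateIdeal := by
  apply le_antisymm
  · obtain ⟨C, rfl⟩ := hA.exists_mul_eq hA'
    exact adjugateIdeal_mul_le_right _ _
  · obtain ⟨C, rfl⟩ := hA'.exists_mul_eq hA
    exact adjugateIdeal_mul_le_right _ _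

/-- The ideal of the entries of the adjugate does not depend on the presentation. -/
theorem adjugateIdeal_eq [DecidableEq ι] [DecidableEq κ] [Nonempty ι] [Nonempty κ]
    (hA : IsPresentation A x) (hB : IsPresentation B y) :
    A.adjugateIdeal = B.adjugateIdeal := by
  have hY : ∀ k, ∃ c : ι → R, ∑ i, c i • x i = y k := fun k =>
    (Submodule.mem_span_range_iff_exists_fun R).1 (hA.span_eq_top ▸ Submodule.mem_top)
  have hX : ∀ i, ∃ c : κ → R, ∑ k, c k • y k = x i := fun i =>
    (Submodule.mem_span_range_iff_exists_fun R).1 (hB.span_eq_top ▸ Submodule.mem_top)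
  choose Y hY using hY
  choose X hX using hX
  -- The two generating families are united. The union is presented by enlarging `A` by the
  -- generators `y`, and also by enlarging `B` by the generators `x`; on a common family the ideals
  -- agree because each matrix is a multiple of the other.
  have h1 := hA.fromBlocks (y := y) (Y := Matrix.of Y) (fun k => (hY k).symm)
  have h2 := (hB.fromBlocks (y := x) (Y := Matrix.of X) (fun k => (hX k).symm)).submatrix
    (Equiv.sumComm ι κ)
  have h3 : Sum.elim y x ∘ Equiv.sumComm ι κ = Sum.elim x y := by
    ext (i | k) <;> rfl
  rw [h3] at h2
  rw [← adjugateIdeal_fromBlocks A (-Matrix.of Y), h1.adjugateIdeal_eq_of_same h2,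
    adjugateIdeal_submatrix_equiv, adjugateIdeal_fromBlocks]

end IsPresentation

end Presentation

end Matrix

/-! ### The Alexander module of a Gauss word -/

namespace GaussWord

open LaurentPolynomial

variable {Q Q' : Type*} [AddCommGroup Q] [Module ℤ[T;T⁻¹] Q]
  [AddCommGroup Q'] [Module ℤ[T;T⁻¹] Q']

/-- The colour of the arc that leaves a passage, if `q` is the colour of the arc that arrives there
and `o` gives the colours of the over-strands of the crossings. -/
noncomputable def step (o : ℕ → Q) (q : Q) (a : GaussLetter) : Q :=
  if a.isOver = true then q
  else (T (-(a.sign : ℤ)) : ℤ[T;T⁻¹]) • q + (1 - T (-(a.sign : ℤ)) : ℤ[T;T⁻¹]) • o a.label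

/-- The colour of the last arc, if `q` is the colour of the first one. -/
noncomputable def run (w : List GaussLetter) (o : ℕ → Q) (q : Q) : Q := w.foldl (step o) q

/-- The differences between the prescribed and the actual colours at the over-passages. -/
noncomputable def defects : List GaussLetter → (ℕ → Q) → Q → List Q
  | [], _, _ => []
  | a :: w, o, q => (if a.isOver = true then o a.label - q else 0) :: defects w o (step o q a)

/-- The prescribed and the actual colours agree at the over-passages. -/
def Consistent (w : List GaussLetter) (o : ℕ → Q) (q : Q) : Prop := ∀ d ∈ defects w o q, d = 0

/-- A colouring of a cyclic Gauss word by elements of a module, given by the colours of the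
over-strands of its crossings and of the arc at the basepoint. -/
structure IsColoring (w : List GaussLetter) (o : ℕ → Q) (q : Q) : Prop where
  consistent : Consistent w o q
  closed : run w o q = q
  -- Every natural number is a possible label, so unused labels must be killed in order not to
  -- contribute free generators.
  eq_zero : ∀ l, (∀ a ∈ w, a.label ≠ l) → o l = 0

@[simp] theorem run_nil (o : ℕ → Q) (q : Q) : run [] o q = q := rfl

@[simp] theorem run_cons (a : GaussLetter) (w : List GaussLetter) (o : ℕ → Q) (q : Q) :
    run (a :: w) o q = run w o (step o q a) := rfl

theorem run_append (u v : List GaussLetter) (o : ℕ → Q) (q : Q) :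
    run (u ++ v) o q = run v o (run u o q) := by
  simp [run, List.foldl_append]

@[simp] theorem consistent_nil (o : ℕ → Q) (q : Q) : Consistent [] o q := by
  simp [Consistent, defects]

@[simp] theorem consistent_cons (a : GaussLetter) (w : List GaussLetter) (o : ℕ → Q) (q : Q) :
    Consistent (a :: w) o q ↔
      (a.isOver = true → o a.label = q) ∧ Consistent w o (step o q a) := by
  unfold Consistent
  simp only [defects, List.mem_cons, forall_eq_or_imp]
  by_cases h : a.isOver = true <;> simp [h, sub_eq_zero]

theorem consistent_append (u v : List GaussLetter) (o : ℕ → Q) (q : Q) :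
    Consistent (u ++ v) o q ↔ Consistent u o q ∧ Consistent v o (run u o q) := by
  induction u generalizing q with
  | nil => simp
  | cons a u ih => simp [ih, and_assoc]

theorem step_congr {o o' : ℕ → Q} {a : GaussLetter} (h : o a.label = o' a.label) (q : Q) :
    step o q a = step o' q a := by
  simp [step, h]

theorem run_congr {w : List GaussLetter} {o o' : ℕ → Q} (h : ∀ a ∈ w, o a.label = o' a.label)
    (q : Q) : run w o q = run w o' q := by
  induction w generalizing q with
  | nil => rfl
  | cons a w ih =>
    rw [run_cons, run_cons, step_congr (h a (by simp)), ih fun b hb => h b (by simp [hb])]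

theorem consistent_congr {w : List GaussLetter} {o o' : ℕ → Q}
    (h : ∀ a ∈ w, o a.label = o' a.label) (q : Q) : Consistent w o q ↔ Consistent w o' q := by
  induction w generalizing q with
  | nil => simp
  | cons a w ih =>
    rw [consistent_cons, consistent_cons, step_congr (h a (by simp)), h a (by simp),
      ih fun b hb => h b (by simp [hb])]

theorem map_step (f : Q →ₗ[ℤ[T;T⁻¹]] Q') (o : ℕ → Q) (q : Q) (a : GaussLetter) :
    f (step o q a) = step (fun l => f (o l)) (f q) a := by
  simp only [step, apply_ite f, map_add, map_smul]

theorem map_run (f : Q →ₗ[ℤ[T;T⁻¹]] Q') (w : List GaussLetter) (o : ℕ → Q) (q : Q) :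
    f (run w o q) = run w (fun l => f (o l)) (f q) := by
  induction w generalizing q with
  | nil => rfl
  | cons a w ih => rw [run_cons, ih, map_step, run_cons]

theorem map_defects (f : Q →ₗ[ℤ[T;T⁻¹]] Q') (w : List GaussLetter) (o : ℕ → Q) (q : Q) :
    defects w (fun l => f (o l)) (f q) = (defects w o q).map f := by
  induction w generalizing q with
  | nil => rfl
  | cons a w ih =>
    simp only [defects, List.map_cons, ← map_step, ih, apply_ite f, map_sub, map_zero]

/-- The free module on the over-strands of all crossings and the arc at the basepoint. -/
abbrev Free : Type := Option ℕ →₀ ℤ[T;T⁻¹]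

/-- The generator for the over-strand of a crossing. -/
noncomputable def overGen (l : ℕ) : Free := Finsupp.single (some l) 1

/-- The generator for the arc at the basepoint. -/
noncomputable def baseGen : Free := Finsupp.single none 1

/-- The linear map with given values on the generators. -/
noncomputable def lift (o : ℕ → Q) (q : Q) : Free →ₗ[ℤ[T;T⁻¹]] Q :=
  Finsupp.linearCombination _ fun x : Option ℕ => x.elim q o

@[simp] theorem lift_overGen (o : ℕ → Q) (q : Q) (l : ℕ) : lift o q (overGen l) = o l := by
  simp [lift, overGen]

@[simp] theorem lift_baseGen (o : ℕ → Q) (q : Q) : lift o q baseGen = q := by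
  simp [lift, baseGen]

theorem hom_ext {P : Type*} [AddCommGroup P] [Module ℤ[T;T⁻¹] P] {f g : Free →ₗ[ℤ[T;T⁻¹]] P}
    (ho : ∀ l, f (overGen l) = g (overGen l)) (hq : f baseGen = g baseGen) : f = g := by
  apply Finsupp.lhom_ext'
  rintro (_ | l)
  · exact LinearMap.ext_ring hq
  · exact LinearMap.ext_ring (ho l)

/-- The relators of the Alexander module of a Gauss word. -/
def relators (w : List GaussLetter) : Set Free :=
  {r | r ∈ defects w overGen baseGen ∨ r = run w overGen baseGen - baseGen ∨
    ∃ l, (∀ a ∈ w, a.label ≠ l) ∧ r = overGen l}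

/-- The Alexander module of a Gauss word: its linear maps to a module `Q` are the colourings by
elements of `Q`. -/
abbrev AlexanderModule (w : List GaussLetter) : Type :=
  Free ⧸ Submodule.span ℤ[T;T⁻¹] (relators w)

theorem isColoring_iff (w : List GaussLetter) (f : Free →ₗ[ℤ[T;T⁻¹]] Q) :
    IsColoring w (fun l => f (overGen l)) (f baseGen) ↔
      Submodule.span ℤ[T;T⁻¹] (relators w) ≤ LinearMap.ker f := by
  rw [Submodule.span_le]
  constructor
  · rintro ⟨h1, h2, h3⟩ r (hr | rfl | ⟨l, hl, rfl⟩)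
    · apply h1
      rw [map_defects]
      exact List.mem_map_of_mem hr
    · rw [SetLike.mem_coe, LinearMap.mem_ker, map_sub, map_run, h2, sub_self]
    · exact h3 l hl
  · intro h
    refine ⟨?_, ?_, ?_⟩
    · intro d hd
      rw [map_defects] at hd
      obtain ⟨r, hr, rfl⟩ := List.mem_map.1 hd
      exact h (Or.inl hr)
    · have : f (run w overGen baseGen - baseGen) = 0 := h (Or.inr (Or.inl rfl))
      rwa [map_sub, map_run, sub_eq_zero] at this
    · intro l hl
      exact h (Or.inr (Or.inr ⟨l, hl, rfl⟩))

/-- The universal colours of over-strands. -/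
noncomputable def univOver (w : List GaussLetter) (l : ℕ) : AlexanderModule w := Submodule.mkQ _ (overGen l)

/-- The universal colour of the arc at the basepoint. -/
noncomputable def univBase (w : List GaussLetter) : AlexanderModule w := Submodule.mkQ _ baseGen

theorem isColoring_univ (w : List GaussLetter) : IsColoring w (univOver w) (univBase w) :=
  (isColoring_iff w (Submodule.span _ (relators w)).mkQ).2 (Submodule.ker_mkQ _).ge

theorem exists_hom {w : List GaussLetter} {o : ℕ → Q} {q : Q} (h : IsColoring w o q) :
    ∃ f : AlexanderModule w →ₗ[ℤ[T;T⁻¹]] Q, (∀ l, f (univOver w l) = o l) ∧ f (univBase w) = q := by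
  have := (isColoring_iff w (lift o q)).1 (by simpa using h)
  refine ⟨Submodule.liftQ _ (lift o q) this, fun l => ?_, ?_⟩
  · exact (Submodule.liftQ_apply _ _ _).trans (by simp)
  · exact (Submodule.liftQ_apply _ _ _).trans (by simp)

theorem alexanderModule_hom_ext {w : List GaussLetter} {f g : AlexanderModule w →ₗ[ℤ[T;T⁻¹]] Q}
    (ho : ∀ l, f (univOver w l) = g (univOver w l)) (hq : f (univBase w) = g (univBase w)) :
    f = g :=
  Submodule.linearMap_qext _ (hom_ext ho hq)

theorem eq_top_of_mem {w : List GaussLetter} {N : Submodule ℤ[T;T⁻¹] (AlexanderModule w)}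
    (ho : ∀ l, univOver w l ∈ N) (hq : univBase w ∈ N) : N = ⊤ := by
  have : N.mkQ = 0 := alexanderModule_hom_ext
    (fun l => (Submodule.Quotient.mk_eq_zero N).2 (ho l)) ((Submodule.Quotient.mk_eq_zero N).2 hq)
  rw [← N.ker_mkQ, this, LinearMap.ker_zero]

/-- Colourings of two words that determine each other by linear formulas give an isomorphism of
Alexander modules. -/
theorem nonempty_equiv {w w' : List GaussLetter} (o₁ : ℕ → Free) (q₁ : Free) (o₂ : ℕ → Free)
    (q₂ : Free)
    (h₁ : ∀ (Q : Type) [AddCommGroup Q] [Module ℤ[T;T⁻¹] Q] (o : ℕ → Q) (q : Q),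
      IsColoring w o q → IsColoring w' (fun l => lift o q (o₁ l)) (lift o q q₁) ∧
        (∀ l, lift (fun l => lift o q (o₁ l)) (lift o q q₁) (o₂ l) = o l) ∧
        lift (fun l => lift o q (o₁ l)) (lift o q q₁) q₂ = q)
    (h₂ : ∀ (Q : Type) [AddCommGroup Q] [Module ℤ[T;T⁻¹] Q] (o : ℕ → Q) (q : Q),
      IsColoring w' o q → IsColoring w (fun l => lift o q (o₂ l)) (lift o q q₂) ∧
        (∀ l, lift (fun l => lift o q (o₂ l)) (lift o q q₂) (o₁ l) = o l) ∧
        lift (fun l => lift o q (o₂ l)) (lift o q q₂) q₁ = q) :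
    Nonempty (AlexanderModule w ≃ₗ[ℤ[T;T⁻¹]] AlexanderModule w') := by
  -- The universal colouring of each word is turned into a colouring of the other word. The
  -- resulting maps of modules are mutually inverse because the formulas are.
  obtain ⟨c₁, ho₁, hq₁⟩ := h₁ _ _ _ (isColoring_univ w)
  obtain ⟨c₂, ho₂, hq₂⟩ := h₂ _ _ _ (isColoring_univ w')
  obtain ⟨f, hfo, hfq⟩ := exists_hom c₂
  obtain ⟨g, hgo, hgq⟩ := exists_hom c₁
  have hf : f ∘ₗ Submodule.mkQ _ = lift (fun l => lift (univOver w') (univBase w') (o₂ l))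
      (lift (univOver w') (univBase w') q₂) :=
    hom_ext (fun l => by rw [lift_overGen]; exact hfo l) (by rw [lift_baseGen]; exact hfq)
  have hg : g ∘ₗ Submodule.mkQ _ = lift (fun l => lift (univOver w) (univBase w) (o₁ l))
      (lift (univOver w) (univBase w) q₁) :=
    hom_ext (fun l => by rw [lift_overGen]; exact hgo l) (by rw [lift_baseGen]; exact hgq)
  have hw : ∀ (w : List GaussLetter) x, lift (univOver w) (univBase w) x = Submodule.mkQ _ x := by
    intro w x
    have : lift (univOver w) (univBase w) = Submodule.mkQ _ :=
      hom_ext (fun l => by simp [univOver]) (by simp [univBase])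
    rw [this]
  refine ⟨LinearEquiv.ofLinearMap f g ?_ ?_⟩
  · refine alexanderModule_hom_ext (fun l => ?_) ?_
    · rw [LinearMap.comp_apply, hgo, hw, ← LinearMap.comp_apply, hf, ho₂]; rfl
    · rw [LinearMap.comp_apply, hgq, hw, ← LinearMap.comp_apply, hf, hq₂]; rfl
  · refine alexanderModule_hom_ext (fun l => ?_) ?_
    · rw [LinearMap.comp_apply, hfo, hw, ← LinearMap.comp_apply, hg, ho₁]; rfl
    · rw [LinearMap.comp_apply, hfq, hw, ← LinearMap.comp_apply, hg, hq₁]; rfl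

end GaussWord

namespace GaussWord

open LaurentPolynomial

/-! ### Invariance of the Alexander module under the elementary moves -/

/-- No passage occurs twice, and the sign of a passage is determined by its crossing. -/
structure IsReduced (w : List GaussLetter) : Prop where
  nodup : w.Nodup
  sign_eq : ∀ a ∈ w, ∀ b ∈ w, a.label = b.label → a.sign = b.sign

theorem _root_.GaussCode.isReduced (D : GaussCode) : IsReduced D.word := ⟨D.nodup, D.sign_eq⟩

theorem IsReduced.perm {w w' : List GaussLetter} (h : IsReduced w) (hw : w.Perm w') :
    IsReduced w' :=
  ⟨hw.nodup_iff.1 h.nodup, fun a ha b hb => h.sign_eq a (hw.mem_iff.2 ha) b (hw.mem_iff.2 hb)⟩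

/-- A third letter with this label would have the same sign and would coincide with one of the two
passages. The freshness of the labels involved in a move rests on this. -/
theorem IsReduced.label_ne {i : ℕ} {e : ℤˣ} {w : List GaussLetter}
    (h : IsReduced (⟨i, true, e⟩ :: ⟨i, false, e⟩ :: w)) : ∀ b ∈ w, b.label ≠ i := by
  rintro ⟨l, o, s⟩ hb hl
  have hs := h.sign_eq _ (List.mem_cons_of_mem _ (List.mem_cons_of_mem _ hb)) _
    List.mem_cons_self hl
  simp only at hl hs
  subst hl hs
  have hn := h.nodup
  rw [List.nodup_cons, List.nodup_cons] at hn
  cases o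
  · exact hn.2.1 hb
  · exact hn.1 (List.mem_cons_of_mem _ hb)

theorem orderedPair_perm (s : ℤˣ) (a b : GaussLetter) : (orderedPair s a b).Perm [a, b] := by
  unfold orderedPair
  split_ifs
  · exact List.Perm.refl _
  · exact List.Perm.swap _ _ _

theorem mem_orderedPair {s : ℤˣ} {a b c : GaussLetter} :
    c ∈ orderedPair s a b ↔ c = a ∨ c = b := by
  rw [(orderedPair_perm s a b).mem_iff]
  simp

variable {Q : Type*} [AddCommGroup Q] [Module ℤ[T;T⁻¹] Q]

theorem isColoring_rotate {u v : List GaussLetter} {o : ℕ → Q} {q : Q}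
    (h : IsColoring (u ++ v) o q) : IsColoring (v ++ u) o (run u o q) := by
  obtain ⟨h1, h2, h3⟩ := h
  rw [consistent_append] at h1
  rw [run_append] at h2
  refine ⟨?_, ?_, fun l hl => h3 l fun a ha => hl a ?_⟩
  · rw [consistent_append, h2]
    exact ⟨h1.2, h1.1⟩
  · rw [run_append, h2]
  · simpa [or_comm] using ha

theorem equiv_basepoint (u v : List GaussLetter) :
    Nonempty (AlexanderModule (u ++ v) ≃ₗ[ℤ[T;T⁻¹]] AlexanderModule (v ++ u)) := by
  refine nonempty_equiv overGen (run u overGen baseGen) overGen (run v overGen baseGen) ?_ ?_ <;>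
  · intro Q _ _ o q h
    have h2 := h.closed
    rw [run_append] at h2
    simp only [map_run, lift_overGen, lift_baseGen, h2, implies_true, and_true]
    exact isColoring_rotate h

theorem run_relabel (f : ℕ → ℕ) (g : Equiv.Perm ℕ) (w : List GaussLetter) (o : ℕ → Q) (q : Q)
    (hf : f = g) : run (w.map (GaussLetter.relabel g)) o q = run w (o ∘ f) q := by
  subst hf
  induction w generalizing q with
  | nil => rfl
  | cons a w ih => exact ih _

theorem consistent_relabel (g : Equiv.Perm ℕ) (w : List GaussLetter) (o : ℕ → Q) (q : Q) :
    Consistent (w.map (GaussLetter.relabel g)) o q ↔ Consistent w (o ∘ g) q := by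
  induction w generalizing q with
  | nil => simp
  | cons a w ih =>
    rw [List.map_cons, consistent_cons, consistent_cons, ih]
    rfl

theorem isColoring_relabel (g : Equiv.Perm ℕ) (w : List GaussLetter) (o : ℕ → Q) (q : Q) :
    IsColoring (w.map (GaussLetter.relabel g)) o q ↔ IsColoring w (o ∘ g) q := by
  constructor
  · rintro ⟨h1, h2, h3⟩
    refine ⟨(consistent_relabel g w o q).1 h1, (run_relabel _ g w o q rfl).symm.trans h2, ?_⟩
    intro l hl
    apply h3
    intro a ha
    obtain ⟨b, hb, rfl⟩ := List.mem_map.1 ha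
    exact fun h => hl b hb (g.injective h)
  · rintro ⟨h1, h2, h3⟩
    refine ⟨(consistent_relabel g w o q).2 h1, (run_relabel _ g w o q rfl).trans h2, ?_⟩
    intro l hl
    have := h3 (g.symm l) fun a ha h =>
      hl _ (List.mem_map_of_mem ha) (by simp [GaussLetter.relabel, h])
    simpa using this

theorem equiv_renumber (g : Equiv.Perm ℕ) (w : List GaussLetter) :
    Nonempty (AlexanderModule w ≃ₗ[ℤ[T;T⁻¹]]
      AlexanderModule (w.map (GaussLetter.relabel g))) := by
  refine nonempty_equiv (fun l => overGen (g.symm l)) baseGen (fun l => overGen (g l)) baseGen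
    ?_ ?_
  · intro Q _ _ o q h
    simp only [lift_overGen, lift_baseGen, Equiv.symm_apply_apply, implies_true, and_true]
    rw [isColoring_relabel]
    convert h using 1
    ext l
    simp
  · intro Q _ _ o q h
    simp only [lift_overGen, lift_baseGen, Equiv.apply_symm_apply, implies_true, and_true]
    exact (isColoring_relabel g w o q).1 h

theorem run_curl (a : GaussLetter) {o : ℕ → Q} {q : Q} (h : o a.label = q) :
    run [a, a.partner] o q = q := by
  obtain ⟨l, b, s⟩ := a
  simp only at h
  cases b <;> simp [GaussLetter.partner, step, h, ← add_smul]

/-- If the over-passage comes first this is its definition. If the under-passage comes first,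
consistency reads `T ^ (-s) • (o l - q) = 0`, and `T ^ (-s)` is a unit. -/
theorem consistent_curl (a : GaussLetter) {o : ℕ → Q} {q : Q} :
    Consistent [a, a.partner] o q ↔ o a.label = q := by
  obtain ⟨l, b, s⟩ := a
  cases b
  · simp only [GaussLetter.partner, consistent_cons, step, consistent_nil]
    simp only [Bool.false_eq_true, ↓reduceIte, Bool.not_false, forall_const, and_true,
      false_imp_iff, true_and]
    constructor
    · intro h
      have h' : (T (-(s : ℤ)) : ℤ[T;T⁻¹]) • (o l - q) = 0 := by
        rw [sub_smul, one_smul] at h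
        rw [smul_sub, sub_eq_zero]
        have := sub_eq_zero.2 h
        rw [← sub_eq_zero, ← this]
        abel
      have h2 := congrArg (fun x => (T (s : ℤ) : ℤ[T;T⁻¹]) • x) h'
      simp only [smul_smul, ← T_add, add_neg_cancel, T_zero, one_smul, smul_zero] at h2
      exact sub_eq_zero.1 h2
    · rintro rfl
      rw [← add_smul, add_sub_cancel, one_smul]
  · simp [GaussLetter.partner, step]

/-- The over-strand of the curl is forced to have the colour of the arc on which the curl sits, and
that colour leaves the curl unchanged. Without the curl its label is unused and has colour zero,
which explains the values in the two substitutions. -/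
theorem equiv_reidemeister1 (a : GaussLetter) (w : List GaussLetter)
    (h : IsReduced ([a, a.partner] ++ w)) :
    Nonempty (AlexanderModule ([a, a.partner] ++ w) ≃ₗ[ℤ[T;T⁻¹]] AlexanderModule w) := by
  have hw : ∀ b ∈ w, b.label ≠ a.label := by
    obtain ⟨l, b, s⟩ := a
    cases b
    · exact (h.perm (List.Perm.swap _ _ _)).label_ne
    · exact h.label_ne
  refine nonempty_equiv (fun l => if l = a.label then 0 else overGen l) baseGen
    (fun l => if l = a.label then baseGen else overGen l) baseGen ?_ ?_
  · intro Q _ _ o q h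
    obtain ⟨h1, h2, h3⟩ := h
    rw [consistent_append, consistent_curl] at h1
    rw [run_append, run_curl a h1.1] at h2
    rw [run_curl a h1.1] at h1
    simp only [apply_ite (lift _ _), lift_overGen, lift_baseGen, map_zero, and_true]
    have hc : ∀ b ∈ w, (fun l => if l = a.label then 0 else o l) b.label = o b.label :=
      fun b hb => if_neg (hw b hb)
    refine ⟨⟨?_, ?_, ?_⟩, ?_⟩
    · exact (consistent_congr hc q).2 h1.2
    · exact (run_congr (Q := Q) (o' := o) hc q).trans h2
    · intro l hl
      split_ifs with hla
      · rfl
      · apply h3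
        intro b hb
        simp only [List.cons_append, List.nil_append, List.mem_cons] at hb
        rcases hb with rfl | rfl | hb
        · exact Ne.symm hla
        · exact Ne.symm hla
        · exact hl b hb
    · intro l
      split_ifs with hla
      · rw [hla, h1.1]
      · rfl
  · intro Q _ _ o q h
    obtain ⟨h1, h2, h3⟩ := h
    simp only [apply_ite (lift _ _), lift_overGen, lift_baseGen, map_zero, and_true]
    have hc : ∀ b ∈ w, (fun l => if l = a.label then q else o l) b.label = o b.label :=
      fun b hb => if_neg (hw b hb)
    have hr : run [a, a.partner] (fun l => if l = a.label then q else o l) q = q :=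
      run_curl a (if_pos rfl)
    refine ⟨⟨?_, ?_, ?_⟩, ?_⟩
    · rw [consistent_append, consistent_curl, hr, consistent_congr hc]
      exact ⟨if_pos rfl, h1⟩
    · rw [run_append, hr, run_congr hc, h2]
    · intro l hl
      rw [if_neg (Ne.symm (hl a (by simp)))]
      exact h3 l fun b hb => hl b (by simp [hb])
    · intro l
      split_ifs with hla
      · rw [hla, h3 _ hw]
      · rfl

/-- Under-passages of opposite signs beneath equal colours act by mutually inverse affine maps. -/
theorem run_undercrossings (i j : ℕ) (e s : ℤˣ) {o : ℕ → Q} (h : o i = o j) (q : Q) :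
    run (orderedPair s ⟨i, false, e⟩ ⟨j, false, -e⟩) o q = q := by
  have hT : (T 1 : ℤ[T;T⁻¹]) * T (-1) = 1 := by rw [← T_add]; simp
  generalize hx : (T 1 : ℤ[T;T⁻¹]) = x at hT
  generalize hy : (T (-1) : ℤ[T;T⁻¹]) = y at hT
  unfold orderedPair
  rcases Int.units_eq_one_or e with rfl | rfl <;> split_ifs <;>
    simp only [run_cons, run_nil, step, Bool.false_eq_true, ↓reduceIte, Units.val_one,
      Units.val_neg, neg_neg, hx, hy, h] <;>
    match_scalars <;> grind

theorem consistent_undercrossings (i j : ℕ) (e e' s : ℤˣ) (o : ℕ → Q) (q : Q) :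
    Consistent (orderedPair s ⟨i, false, e⟩ ⟨j, false, e'⟩) o q := by
  unfold orderedPair
  split_ifs <;> simp

theorem equiv_reidemeister2 (i j : ℕ) (e s : ℤˣ) (u v : List GaussLetter)
    (h : IsReduced ([⟨i, true, e⟩, ⟨j, true, -e⟩] ++ u ++
      orderedPair s ⟨i, false, e⟩ ⟨j, false, -e⟩ ++ v)) :
    Nonempty (AlexanderModule ([⟨i, true, e⟩, ⟨j, true, -e⟩] ++ u ++
      orderedPair s ⟨i, false, e⟩ ⟨j, false, -e⟩ ++ v) ≃ₗ[ℤ[T;T⁻¹]]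
        AlexanderModule (u ++ v)) := by
  have hp : List.Perm ([⟨i, true, e⟩, ⟨j, true, -e⟩] ++ u ++
      orderedPair s ⟨i, false, e⟩ ⟨j, false, -e⟩ ++ v)
      ([⟨i, true, e⟩, ⟨j, true, -e⟩] ++ u ++ [⟨i, false, e⟩, ⟨j, false, -e⟩] ++ v) :=
    ((orderedPair_perm s (⟨i, false, e⟩ : GaussLetter) ⟨j, false, -e⟩).append_left _).append_right _
  have hi : ∀ b ∈ u ++ v, b.label ≠ i := by
    intro b hb
    refine (h.perm (hp.trans (l₃ := (⟨i, true, e⟩ : GaussLetter) ::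
      ⟨i, false, e⟩ :: ([⟨j, true, -e⟩, ⟨j, false, -e⟩] ++ (u ++ v))) ?_)).label_ne b (by simp_all)
    rw [List.perm_iff_count]
    intro x
    simp only [List.count_append, List.count_cons, List.count_nil]
    omega
  have hj : ∀ b ∈ u ++ v, b.label ≠ j := by
    intro b hb
    refine (h.perm (hp.trans (l₃ := (⟨j, true, -e⟩ : GaussLetter) ::
      ⟨j, false, -e⟩ :: ([⟨i, true, e⟩, ⟨i, false, e⟩] ++ (u ++ v))) ?_)).label_ne b (by simp_all)
    rw [List.perm_iff_count]
    intro x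
    simp only [List.count_append, List.count_cons, List.count_nil]
    omega
  have hmem : ∀ b, b ∈ [⟨i, true, e⟩, ⟨j, true, -e⟩] ++ u ++
      orderedPair s ⟨i, false, e⟩ ⟨j, false, -e⟩ ++ v → b.label = i ∨ b.label = j ∨ b ∈ u ++ v := by
    intro b hb
    rw [hp.mem_iff] at hb
    simp only [List.mem_append, List.mem_cons, List.not_mem_nil, or_false] at hb
    rcases hb with (((rfl | rfl) | hb) | (rfl | rfl)) | hb <;> simp [*]
  refine nonempty_equiv (fun l => if l = i ∨ l = j then 0 else overGen l) baseGen
    (fun l => if l = i ∨ l = j then baseGen else overGen l) baseGen ?_ ?_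
  · intro Q _ _ o q h
    obtain ⟨h1, h2, h3⟩ := h
    rw [List.append_assoc, List.append_assoc, consistent_append, consistent_append,
      consistent_append] at h1
    rw [List.append_assoc, List.append_assoc, run_append, run_append, run_append] at h2
    have ho : o i = q ∧ o j = q := by simpa [step] using h1.1
    have hr : run [⟨i, true, e⟩, ⟨j, true, -e⟩] o q = q := by simp [step]
    rw [hr, run_undercrossings i j e s (ho.1.trans ho.2.symm)] at h1 h2
    simp only [apply_ite (lift _ _), lift_overGen, lift_baseGen, map_zero, and_true]
    have hc : ∀ b ∈ u ++ v, 
        (fun l => if l = i ∨ l = j then 0 else o l) b.label = o b.label :=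
      fun b hb => if_neg (by simp [hi b hb, hj b hb])
    refine ⟨⟨?_, ?_, ?_⟩, ?_⟩
    · rw [consistent_congr hc, consistent_append]
      exact ⟨h1.2.1, h1.2.2.2⟩
    · rw [run_congr hc, run_append, h2]
    · intro l hl
      split_ifs with hla
      · rfl
      · apply h3
        intro b hb hbl
        rcases hmem b hb with h | h | h
        · exact hla (Or.inl (hbl.symm.trans h))
        · exact hla (Or.inr (hbl.symm.trans h))
        · exact hl b h hbl
    · intro l
      split_ifs with hla
      · rcases hla with rfl | rfl
        · exact ho.1.symm
        · exact ho.2.symm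
      · rfl
  · intro Q _ _ o q h
    obtain ⟨h1, h2, h3⟩ := h
    simp only [apply_ite (lift _ _), lift_overGen, lift_baseGen, map_zero, and_true]
    have hc : ∀ b ∈ u ++ v, 
        (fun l => if l = i ∨ l = j then q else o l) b.label = o b.label :=
      fun b hb => if_neg (by simp [hi b hb, hj b hb])
    have hcu := fun b hb => hc b (List.mem_append_left v hb)
    have hcv := fun b hb => hc b (List.mem_append_right u hb)
    have hr : ∀ o : ℕ → Q, run [⟨i, true, e⟩, ⟨j, true, -e⟩] o q = q := by simp [step]
    rw [consistent_append] at h1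
    rw [run_append] at h2
    refine ⟨⟨?_, ?_, ?_⟩, ?_⟩
    · rw [List.append_assoc, List.append_assoc, consistent_append, consistent_append,
        consistent_append, hr, run_undercrossings i j e s (by simp), consistent_congr (w := u) hcu,
        run_congr (w := u) hcu, consistent_congr (w := v) hcv]
      exact ⟨by simp [step], h1.1, consistent_undercrossings _ _ _ _ _ _ _, h1.2⟩
    · rw [List.append_assoc, List.append_assoc, run_append, run_append, run_append, hr,
        run_undercrossings i j e s (by simp), run_congr (w := u) hcu, run_congr (w := v) hcv, h2]
    · intro l hl
      rw [if_neg]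
      · exact h3 l fun b hb => hl b (by
          simp only [List.mem_append] at hb ⊢
          tauto)
      · rintro (rfl | rfl)
        · exact hl ⟨l, true, e⟩ (by simp) rfl
        · exact hl ⟨l, true, -e⟩ (by simp) rfl
    · intro l
      split_ifs with hla
      · rcases hla with rfl | rfl
        · exact (h3 _ hi).symm
        · exact (h3 _ hj).symm
      · rfl

end GaussWord

/-! ### Invariance under the third Reidemeister move -/

namespace GaussWord

open LaurentPolynomial

variable {Q : Type*} [AddCommGroup Q] [Module ℤ[T;T⁻¹] Q]

/-- The colours of over-strands after a third Reidemeister move. -/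
noncomputable def slideOver (i k : ℕ) (c : ℤˣ) (o : ℕ → Q) (l : ℕ) : Q :=
  if l = k then (T (c : ℤ) : ℤ[T;T⁻¹]) • o k + (1 - T (c : ℤ) : ℤ[T;T⁻¹]) • o i else o l

theorem slideOver_self (i k : ℕ) (c : ℤˣ) (o : ℕ → Q) :
    slideOver i k c o k = (T (c : ℤ) : ℤ[T;T⁻¹]) • o k + (1 - T (c : ℤ) : ℤ[T;T⁻¹]) • o i :=
  if_pos rfl

theorem slideOver_of_ne {i k l : ℕ} (h : l ≠ k) (c : ℤˣ) (o : ℕ → Q) :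
    slideOver i k c o l = o l :=
  if_neg h

theorem slideOver_slideOver {i k : ℕ} (h : i ≠ k) (c : ℤˣ) (o : ℕ → Q) :
    slideOver i k (-c) (slideOver i k c o) = o := by
  ext l
  by_cases hl : l = k
  · subst hl
    rw [slideOver_self, slideOver_self, slideOver_of_ne h]
    have hT : (T (c : ℤ) : ℤ[T;T⁻¹]) * T (-(c : ℤ)) = 1 := by rw [← T_add]; simp
    rw [Units.val_neg]
    generalize (T (c : ℤ) : ℤ[T;T⁻¹]) = x at hT
    generalize (T (-(c : ℤ)) : ℤ[T;T⁻¹]) = y at hT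
    match_scalars <;> grind
  · rw [slideOver_of_ne hl, slideOver_of_ne hl]

theorem consistent_top (i j : ℕ) (x y s : ℤˣ) (o : ℕ → Q) (q : Q) :
    Consistent (orderedPair s ⟨i, true, x⟩ ⟨j, true, y⟩) o q ↔ o i = q ∧ o j = q := by
  unfold orderedPair
  split_ifs <;> simp [step, and_comm]

theorem run_top (i j : ℕ) (x y s : ℤˣ) (o : ℕ → Q) (q : Q) :
    run (orderedPair s ⟨i, true, x⟩ ⟨j, true, y⟩) o q = q := by
  unfold orderedPair
  split_ifs <;> simp [step]

/-- The move exchanges, along the middle strand, its passage under the top strand and its passage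
over the bottom one. The colour seen at `k` is thus pushed through the crossing `i`, forwards or
backwards according to `d * z`; this accounts for the exponent `x * d * z`. -/
theorem slide_middle {i k : ℕ} (hik : i ≠ k) (x z d : ℤˣ) (o : ℕ → Q) (q : Q)
    (h : Consistent (orderedPair (d * z) ⟨i, false, x⟩ ⟨k, true, z⟩) o q) :
    Consistent (orderedPair (-d * z) ⟨i, false, x⟩ ⟨k, true, z⟩) (slideOver i k (x * d * z) o) q ∧
      run (orderedPair (-d * z) ⟨i, false, x⟩ ⟨k, true, z⟩) (slideOver i k (x * d * z) o) q =
        run (orderedPair (d * z) ⟨i, false, x⟩ ⟨k, true, z⟩) o q := by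
  have hT : (T 1 : ℤ[T;T⁻¹]) * T (-1) = 1 := by rw [← T_add]; simp
  generalize hx : (T 1 : ℤ[T;T⁻¹]) = t at hT
  generalize hy : (T (-1) : ℤ[T;T⁻¹]) = t' at hT
  have h1 : ((-1 : ℤˣ) = 1) = False := by simp
  rcases Int.units_eq_one_or x with rfl | rfl <;> rcases Int.units_eq_one_or z with rfl | rfl <;>
    rcases Int.units_eq_one_or d with rfl | rfl <;>
    simp only [orderedPair, mul_one, neg_neg, mul_neg, h1, ↓reduceIte,
      consistent_cons, consistent_nil, step, Bool.false_eq_true, false_imp_iff, true_and,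
      forall_const, and_true, slideOver_self, slideOver_of_ne hik, run_cons, run_nil,
      Units.val_one, Units.val_neg, hx, hy] at h ⊢ <;>
    rw [h] <;> (try match_scalars) <;> grind

/-- This is the self-distributivity of the operation `(q, r) ↦ T • q + (1 - T) • r` and its inverse:
passing under the middle and the top strand in either order agrees once the middle colour has been
moved past the top one. Each choice of signs is an identity in `t` and `t'` with `t * t' = 1`. -/
theorem slide_bottom {i j k : ℕ} (hjk : j ≠ k) (x y z d : ℤˣ) (o : ℕ → Q) (q : Q)
    (h : o i = o j) :
    run (orderedPair (-d * x * y * z) ⟨j, false, y⟩ ⟨k, false, z⟩)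
        (slideOver i k (x * d * z) o) q =
      run (orderedPair (d * x * y * z) ⟨j, false, y⟩ ⟨k, false, z⟩) o q := by
  have hT : (T 1 : ℤ[T;T⁻¹]) * T (-1) = 1 := by rw [← T_add]; simp
  generalize hx : (T 1 : ℤ[T;T⁻¹]) = t at hT
  generalize hy : (T (-1) : ℤ[T;T⁻¹]) = t' at hT
  have h1 : ((-1 : ℤˣ) = 1) = False := by simp
  rcases Int.units_eq_one_or x with rfl | rfl <;> rcases Int.units_eq_one_or z with rfl | rfl <;>
    rcases Int.units_eq_one_or d with rfl | rfl <;> rcases Int.units_eq_one_or y with rfl | rfl <;>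
    simp only [orderedPair, mul_one, neg_neg, mul_neg, h1, ↓reduceIte,
      step, Bool.false_eq_true, slideOver_self, slideOver_of_ne hjk, run_cons, run_nil,
      Units.val_one, Units.val_neg, hx, hy, h] <;>
    match_scalars <;> grind

/-- Local replacements that preserve consistency and the outgoing colour can be made inside a long
word, provided the colours used in the untouched parts stay the same. -/
theorem slide_chain {A B C A' B' C' u v w : List GaussLetter} {o o' : ℕ → Q} {q : Q}
    (hc : ∀ b ∈ u ++ v ++ w, o' b.label = o b.label)
    (hA : ∀ q, Consistent A o q → Consistent A' o' q ∧ run A' o' q = run A o q)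
    (hB : ∀ q, Consistent B o q → Consistent B' o' q ∧ run B' o' q = run B o q)
    (hC : ∀ q, Consistent C o q → Consistent C' o' q ∧ run C' o' q = run C o q)
    (h : Consistent (A ++ u ++ B ++ v ++ C ++ w) o q) :
    Consistent (A' ++ u ++ B' ++ v ++ C' ++ w) o' q ∧
      run (A' ++ u ++ B' ++ v ++ C' ++ w) o' q = run (A ++ u ++ B ++ v ++ C ++ w) o q := by
  have hu : ∀ b ∈ u, o' b.label = o b.label := fun b hb => hc b (by simp [hb])
  have hv : ∀ b ∈ v, o' b.label = o b.label := fun b hb => hc b (by simp [hb])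
  have hw : ∀ b ∈ w, o' b.label = o b.label := fun b hb => hc b (by simp [hb])
  simp only [consistent_append, run_append, consistent_congr hu, consistent_congr hv,
    consistent_congr hw, run_congr hu, run_congr hv, run_congr hw] at h ⊢
  obtain ⟨⟨⟨⟨⟨h1, h2⟩, h3⟩, h4⟩, h5⟩, h6⟩ := h
  have hA' := hA _ h1
  rw [hA'.2]
  have hB' := hB _ h3
  rw [hB'.2]
  have hC' := hC _ h5
  rw [hC'.2]
  exact ⟨⟨⟨⟨⟨⟨hA'.1, h2⟩, hB'.1⟩, h4⟩, hC'.1⟩, h6⟩, rfl⟩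

/-- A colouring stays a colouring when the three strands of a triangle are slid over each other;
the passages of the middle and bottom strands may come in either order. -/
theorem isColoring_slide {i j k : ℕ} {x y z d : ℤˣ} {A B C A' B' C' u v w : List GaussLetter}
    (hik : i ≠ k) (hjk : j ≠ k) (hk : ∀ b ∈ u ++ v ++ w, b.label ≠ k)
    (hA : A = orderedPair (d * y) ⟨i, true, x⟩ ⟨j, true, y⟩)
    (hA' : A' = orderedPair (-d * y) ⟨i, true, x⟩ ⟨j, true, y⟩)
    (hBC : (B = orderedPair (d * z) ⟨i, false, x⟩ ⟨k, true, z⟩ ∧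
        B' = orderedPair (-d * z) ⟨i, false, x⟩ ⟨k, true, z⟩ ∧
        C = orderedPair (d * x * y * z) ⟨j, false, y⟩ ⟨k, false, z⟩ ∧
        C' = orderedPair (-d * x * y * z) ⟨j, false, y⟩ ⟨k, false, z⟩) ∨
      (B = orderedPair (d * x * y * z) ⟨j, false, y⟩ ⟨k, false, z⟩ ∧
        B' = orderedPair (-d * x * y * z) ⟨j, false, y⟩ ⟨k, false, z⟩ ∧
        C = orderedPair (d * z) ⟨i, false, x⟩ ⟨k, true, z⟩ ∧
        C' = orderedPair (-d * z) ⟨i, false, x⟩ ⟨k, true, z⟩))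
    {o : ℕ → Q} {q : Q} (h : IsColoring (A ++ u ++ B ++ v ++ C ++ w) o q) :
    IsColoring (A' ++ u ++ B' ++ v ++ C' ++ w) (slideOver i k (x * d * z) o) q := by
  obtain ⟨h1, h2, h3⟩ := h
  have hij' : o i = o j := by
    have := h1
    rw [List.append_assoc, List.append_assoc, List.append_assoc, List.append_assoc,
      consistent_append, hA, consistent_top] at this
    exact this.1.1.trans this.1.2.symm
  have hmid := slide_middle hik x z d o
  have hbot : ∀ q, Consistent (orderedPair (d * x * y * z) ⟨j, false, y⟩ ⟨k, false, z⟩) o q →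
      _ ∧ _ := fun q _ =>
    ⟨consistent_undercrossings j k y z (-d * x * y * z) (slideOver i k (x * d * z) o) q,
      slide_bottom hjk x y z d o q hij'⟩
  have key := slide_chain (A := A) (A' := A') (B := B) (B' := B') (C := C) (C' := C')
    (o := o) (o' := slideOver i k (x * d * z) o) (q := q)
    (fun b hb => slideOver_of_ne (hk b hb) _ _)
    (by
      intro q hq
      rw [hA, consistent_top] at hq
      rw [hA, hA', consistent_top, run_top, run_top, slideOver_of_ne hik, slideOver_of_ne hjk]
      exact ⟨hq, rfl⟩)
    (by rcases hBC with ⟨rfl, rfl, rfl, rfl⟩ | ⟨rfl, rfl, rfl, rfl⟩ <;> assumption)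
    (by rcases hBC with ⟨rfl, rfl, rfl, rfl⟩ | ⟨rfl, rfl, rfl, rfl⟩ <;> assumption) h1
  refine ⟨key.1, key.2.trans h2, fun l hl => ?_⟩
  have hmem : ∀ b, b ∈ A ++ u ++ B ++ v ++ C ++ w → b ∈ A' ++ u ++ B' ++ v ++ C' ++ w := by
    intro b hb
    rcases hBC with ⟨rfl, rfl, rfl, rfl⟩ | ⟨rfl, rfl, rfl, rfl⟩ <;>
      simpa only [hA, hA', List.mem_append, mem_orderedPair] using hb
  rw [slideOver_of_ne]
  · exact h3 l fun b hb => hl b (hmem b hb)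
  · rintro rfl
    refine hl ⟨l, true, z⟩ ?_ rfl
    rcases hBC with ⟨rfl, rfl, rfl, rfl⟩ | ⟨rfl, rfl, rfl, rfl⟩ <;>
      simp only [List.mem_append, mem_orderedPair, true_or, or_true]

theorem equiv_slide {i j k : ℕ} {x y z d : ℤˣ} {A B C A' B' C' u v w : List GaussLetter}
    (hr : IsReduced (A ++ u ++ B ++ v ++ C ++ w))
    (hA : A = orderedPair (d * y) ⟨i, true, x⟩ ⟨j, true, y⟩)
    (hA' : A' = orderedPair (-d * y) ⟨i, true, x⟩ ⟨j, true, y⟩)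
    (hBC : (B = orderedPair (d * z) ⟨i, false, x⟩ ⟨k, true, z⟩ ∧
        B' = orderedPair (-d * z) ⟨i, false, x⟩ ⟨k, true, z⟩ ∧
        C = orderedPair (d * x * y * z) ⟨j, false, y⟩ ⟨k, false, z⟩ ∧
        C' = orderedPair (-d * x * y * z) ⟨j, false, y⟩ ⟨k, false, z⟩) ∨
      (B = orderedPair (d * x * y * z) ⟨j, false, y⟩ ⟨k, false, z⟩ ∧
        B' = orderedPair (-d * x * y * z) ⟨j, false, y⟩ ⟨k, false, z⟩ ∧
        C = orderedPair (d * z) ⟨i, false, x⟩ ⟨k, true, z⟩ ∧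
        C' = orderedPair (-d * z) ⟨i, false, x⟩ ⟨k, true, z⟩)) :
    Nonempty (AlexanderModule (A ++ u ++ B ++ v ++ C ++ w) ≃ₗ[ℤ[T;T⁻¹]]
      AlexanderModule (A' ++ u ++ B' ++ v ++ C' ++ w)) := by
  have hp : (A ++ u ++ B ++ v ++ C ++ w).Perm
      ([(⟨i, true, x⟩ : GaussLetter), ⟨i, false, x⟩, ⟨j, true, y⟩, ⟨j, false, y⟩, ⟨k, true, z⟩,
        ⟨k, false, z⟩] ++ (u ++ v ++ w)) := by
    rw [List.perm_iff_count]
    intro c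
    have h1 := fun s a b => List.perm_iff_count.1 (orderedPair_perm s a b) c
    rcases hBC with ⟨rfl, -, rfl, -⟩ | ⟨rfl, -, rfl, -⟩ <;>
    · simp only [hA, List.count_append, h1, List.count_cons, List.count_nil]
      omega
  have hr' := hr.perm hp
  have hk := (hr'.perm (w' := (⟨k, true, z⟩ : GaussLetter) :: ⟨k, false, z⟩ ::
    ([(⟨i, true, x⟩ : GaussLetter), ⟨i, false, x⟩, ⟨j, true, y⟩, ⟨j, false, y⟩] ++
      (u ++ v ++ w))) (by
        rw [List.perm_iff_count]
        intro c
        simp only [List.count_append, List.count_cons, List.count_nil]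
        omega)).label_ne
  have hik : i ≠ k := hk ⟨i, true, x⟩ (by simp)
  have hjk : j ≠ k := hk ⟨j, true, y⟩ (by simp)
  have hk' : ∀ b ∈ u ++ v ++ w, b.label ≠ k := fun b hb => hk b (List.mem_append_right _ hb)
  have hlift : ∀ (c : ℤˣ) (Q : Type) [AddCommGroup Q] [Module ℤ[T;T⁻¹] Q] (o : ℕ → Q) (q : Q),
      (fun l => lift o q (slideOver i k c overGen l)) = slideOver i k c o := by
    intro c Q _ _ o q
    ext l
    simp only [slideOver, apply_ite (lift o q), map_add, map_smul, lift_overGen]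
  refine nonempty_equiv (slideOver i k (x * d * z) overGen) baseGen
    (slideOver i k (-(x * d * z)) overGen) baseGen ?_ ?_
  · intro Q _ _ o q h
    have h1 := fun l => congrFun (hlift (-(x * d * z)) Q (slideOver i k (x * d * z) o) q) l
    simp only [hlift, lift_baseGen, h1, slideOver_slideOver hik, implies_true, and_true]
    exact isColoring_slide hik hjk hk' hA hA' hBC h
  · intro Q _ _ o q h
    have h1 := fun l => congrFun (hlift (x * d * z) Q (slideOver i k (-(x * d * z)) o) q) l
    have h2 := slideOver_slideOver hik (-(x * d * z)) o
    rw [neg_neg] at h2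
    simp only [hlift, lift_baseGen, h1, h2, implies_true, and_true]
    -- The inverse move is the same move with `d` replaced by `-d`, and this negates the exponent of
    -- the slide.
    have h3 := isColoring_slide (A' := A) (B' := B) (C' := C) (d := -d) hik hjk hk' hA' (by rw [neg_neg]; exact hA) (by
      rw [neg_neg]
      rcases hBC with ⟨a, b, c, d⟩ | ⟨a, b, c, d⟩
      · exact Or.inl ⟨b, a, d, c⟩
      · exact Or.inr ⟨b, a, d, c⟩) h
    simpa using h3

theorem equiv_of_move {w w' : List GaussLetter} (h : GaussMove w w') (hw : IsReduced w) :
    Nonempty (AlexanderModule w ≃ₗ[ℤ[T;T⁻¹]] AlexanderModule w') := by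
  cases h with
  | basepoint u v => exact equiv_basepoint u v
  | renumber f => exact equiv_renumber f w
  | reidemeister1 a => exact equiv_reidemeister1 a _ hw
  | reidemeister2 i j e s u v => exact equiv_reidemeister2 i j e s u v hw
  | reidemeister3 i j k x y z d u v w =>
    exact equiv_slide hw rfl rfl (Or.inl ⟨rfl, rfl, rfl, rfl⟩)
  | reidemeister3' i j k x y z d u v w =>
    exact equiv_slide hw rfl rfl (Or.inr ⟨rfl, rfl, rfl, rfl⟩)

/-- Each generating relation joins two Gauss codes, so the words met along a chain of moves are all
reduced. -/
theorem equiv_of_knot_eq {D D' : GaussCode} (h : D.knot = D'.knot) :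
    Nonempty (AlexanderModule D.word ≃ₗ[ℤ[T;T⁻¹]] AlexanderModule D'.word) := by
  replace h := Quot.eqvGen_exact h
  induction h with
  | rel D D' h => exact equiv_of_move h D.isReduced
  | refl D => exact ⟨LinearEquiv.refl _ _⟩
  | symm D D' _ ih => exact ih.map LinearEquiv.symm
  | trans D D' D'' _ _ ih₁ ih₂ =>
    obtain ⟨e₁⟩ := ih₁
    obtain ⟨e₂⟩ := ih₂
    exact ⟨e₁.trans e₂⟩

end GaussWord

/-! ### The Jacobian matrix presents the Alexander module -/

namespace GaussWord

open LaurentPolynomial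

/-- The first under-passage at or after a position of a cyclic Gauss word. -/
def firstUnder (w : List GaussLetter) (k : ℕ) : Option GaussLetter :=
  (w.rotate k).find? fun b => !b.isOver

theorem rotate_eq_cons {w : List GaussLetter} {k : ℕ} (hk : k < w.length) :
    w.rotate k = w[k] :: (w.drop (k + 1) ++ w.take k) := by
  rw [List.rotate_eq_drop_append_take hk.le, List.drop_eq_getElem_cons hk, List.cons_append]

theorem firstUnder_of_under {w : List GaussLetter} {k : ℕ} (hk : k < w.length)
    (h : w[k].isOver = false) : firstUnder w k = some w[k] := by
  rw [firstUnder, rotate_eq_cons hk, List.find?_cons_of_pos]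
  simp [h]

theorem firstUnder_of_over {w : List GaussLetter} {k : ℕ} (hk : k < w.length)
    (h : w[k].isOver = true) : firstUnder w k = firstUnder w (k + 1) := by
  rw [firstUnder, firstUnder, ← List.rotate_rotate, rotate_eq_cons hk, List.find?_cons_of_neg]
  · rw [List.rotate_cons_succ, List.rotate_zero]
    simp only [List.find?_append, List.find?_cons, h, Bool.not_true, List.find?_nil,
      Option.or_none]
  · simp [h]

theorem firstUnder_length (w : List GaussLetter) : firstUnder w w.length = firstUnder w 0 := by
  simp [firstUnder]

theorem firstUnder_eq_some {w : List GaussLetter} {k : ℕ} {b : GaussLetter}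
    (h : firstUnder w k = some b) : b ∈ w ∧ b.isOver = false :=
  ⟨List.mem_rotate.1 (List.mem_of_find?_eq_some h), by simpa using List.find?_some h⟩

theorem exists_firstUnder {w : List GaussLetter} (h : ∃ a ∈ w, a.isOver = false) (k : ℕ) :
    ∃ b, firstUnder w k = some b := by
  rw [← Option.isSome_iff_exists, firstUnder, List.find?_isSome]
  obtain ⟨a, ha, h⟩ := h
  exact ⟨a, List.mem_rotate.2 ha, by simp [h]⟩

/-- Induction backwards around a circle. -/
theorem cyclic_induction {N : ℕ} {P : ℕ → Prop} (hs : ∀ k < N, P (k + 1) → P k) (h0 : P 0 → P N)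
    (hex : ∃ k ≤ N, P k) : ∀ k ≤ N, P k := by
  have hdown : ∀ n ≤ N, P n → ∀ k ≤ n, P k := by
    intro n
    induction n with
    | zero =>
      intro _ h k hk
      rwa [Nat.le_zero.1 hk]
    | succ n ih =>
      intro hn h k hk
      rcases Nat.le_succ_iff.1 hk with hk | rfl
      · exact ih (by omega) (hs n (by omega) h) k hk
      · exact h
  obtain ⟨n, hn, h⟩ := hex
  exact hdown N le_rfl (h0 (hdown n hn h 0 (Nat.zero_le n)))

variable {Q : Type*} [AddCommGroup Q] [Module ℤ[T;T⁻¹] Q]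

/-- The colour of the arc that arrives at a position of a Gauss word. -/
noncomputable def state (w : List GaussLetter) (o : ℕ → Q) (q : Q) (k : ℕ) : Q :=
  run (w.take k) o q

theorem state_zero (w : List GaussLetter) (o : ℕ → Q) (q : Q) : state w o q 0 = q := by
  simp [state]

theorem state_length (w : List GaussLetter) (o : ℕ → Q) (q : Q) :
    state w o q w.length = run w o q := by
  simp [state]

theorem state_succ {w : List GaussLetter} {k : ℕ} (hk : k < w.length) (o : ℕ → Q) (q : Q) :
    state w o q (k + 1) = step o (state w o q k) w[k] := by
  rw [state, List.take_succ_eq_append_getElem hk, run_append]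
  rfl

theorem consistent_iff {w : List GaussLetter} {o : ℕ → Q} {q : Q} :
    Consistent w o q ↔
      ∀ (k : ℕ) (hk : k < w.length), w[k].isOver = true → o w[k].label = state w o q k := by
  induction w generalizing q with
  | nil => simp
  | cons a w ih =>
    rw [consistent_cons, ih]
    constructor
    · rintro ⟨h1, h2⟩ (_ | k) hk h
      · exact h1 h
      · exact h2 k (by simpa using hk) h
    · intro h
      exact ⟨h 0 (by simp), fun k hk hko => h (k + 1) (by simpa using hk) hko⟩

theorem state_succ_of_over {w : List GaussLetter} {k : ℕ} (hk : k < w.length)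
    (h : w[k].isOver = true) (o : ℕ → Q) (q : Q) : state w o q (k + 1) = state w o q k := by
  rw [state_succ hk, step, if_pos h]

/-- Colours change only at under-passages. The induction runs backwards because an over-passage sees
the same next under-passage as the position after it; closedness of the colouring carries it across
the basepoint. -/
theorem state_eq_of_firstUnder {w : List GaussLetter} (hw : w.Nodup) {o : ℕ → Q} {q : Q}
    (h : run w o q = q) {k : ℕ} (hk : k ≤ w.length) {b : GaussLetter}
    (hb : firstUnder w k = some b) : state w o q k = state w o q (w.idxOf b) := by
  have hunder : ∀ (n : ℕ) (hn : n < w.length), w[n].isOver = false →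
      ∀ b, firstUnder w n = some b → state w o q n = state w o q (w.idxOf b) := by
    intro n hn hno b hb
    rw [firstUnder_of_under hn hno, Option.some_inj] at hb
    rw [← hb, hw.idxOf_getElem]
  refine cyclic_induction (N := w.length)
    (P := fun k => ∀ b, firstUnder w k = some b → state w o q k = state w o q (w.idxOf b))
    ?_ ?_ ?_ k hk b hb
  · intro n hn ih b hb
    by_cases hno : w[n].isOver = true
    · rw [firstUnder_of_over hn hno] at hb
      rw [← ih b hb, state_succ_of_over hn hno]
    · exact hunder n hn (by simpa using hno) b hb
  · intro h0 b hb
    rw [firstUnder_length] at hb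
    rw [← h0 b hb, state_length, state_zero, h]
  · obtain ⟨hbw, hbo⟩ := firstUnder_eq_some hb
    have hlt := List.idxOf_lt_length_iff.2 hbw
    exact ⟨w.idxOf b, hlt.le, hunder _ hlt (by simpa using hbo)⟩

end GaussWord

/-! ### Long arcs as generators of the Alexander module -/

namespace GaussCode

open LaurentPolynomial GaussWord

variable {Q : Type*} [AddCommGroup Q] [Module ℤ[T;T⁻¹] Q] (D : GaussCode)

theorem eq_of_label_eq {a b : GaussLetter} (ha : a ∈ D.word) (hb : b ∈ D.word)
    (h : a.label = b.label) (ho : a.isOver = b.isOver) : a = b :=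
  GaussLetter.ext h ho (D.sign_eq a ha b hb h)

theorem under_mem (a : D.Under) : a.1 ∈ D.word :=
  List.mem_toFinset.1 (Finset.mem_filter.1 a.2).1

theorem under_isOver (a : D.Under) : a.1.isOver = false := (Finset.mem_filter.1 a.2).2

theorem exists_under_eq {k : ℕ} {b : GaussLetter} (h : firstUnder D.word k = some b) :
    ∃ b' : D.Under, b'.1 = b := by
  obtain ⟨h1, h2⟩ := firstUnder_eq_some h
  exact ⟨⟨b, Finset.mem_filter.2 ⟨List.mem_toFinset.2 h1, h2⟩⟩, rfl⟩

theorem exists_firstUnder_eq [Nonempty D.Under] (k : ℕ) :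
    ∃ b : D.Under, firstUnder D.word k = some b.1 := by
  obtain ⟨a⟩ := ‹Nonempty D.Under›
  obtain ⟨b, hb⟩ := exists_firstUnder ⟨a.1, D.under_mem a, D.under_isOver a⟩ k
  obtain ⟨b', rfl⟩ := D.exists_under_eq hb
  exact ⟨b', hb⟩

/-- The long arc to which the short arc that arrives at a position belongs. -/
noncomputable def longArc [Nonempty D.Under] (k : ℕ) : D.Under := (D.exists_firstUnder_eq k).choose

theorem firstUnder_eq_longArc [Nonempty D.Under] (k : ℕ) :
    firstUnder D.word k = some (D.longArc k).1 :=
  (D.exists_firstUnder_eq k).choose_spec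

theorem longArc_eq_of_firstUnder_eq [Nonempty D.Under] {k l : ℕ}
    (h : firstUnder D.word k = firstUnder D.word l) : D.longArc k = D.longArc l := by
  rw [firstUnder_eq_longArc, firstUnder_eq_longArc, Option.some_inj] at h
  exact Subtype.ext h

theorem longArc_length [Nonempty D.Under] : D.longArc D.word.length = D.longArc 0 :=
  D.longArc_eq_of_firstUnder_eq (firstUnder_length _)

theorem longArc_of_over [Nonempty D.Under] {k : ℕ} (hk : k < D.word.length)
    (h : D.word[k].isOver = true) : D.longArc (k + 1) = D.longArc k :=
  D.longArc_eq_of_firstUnder_eq (firstUnder_of_over hk h).symm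

theorem longArc_of_under [Nonempty D.Under] {k : ℕ} (hk : k < D.word.length)
    (h : D.word[k].isOver = false) : (D.longArc k).1 = D.word[k] := by
  have := firstUnder_of_under hk h
  rwa [firstUnder_eq_longArc, Option.some_inj] at this

theorem idxOf_lt {a : GaussLetter} (ha : a ∈ D.word) : D.word.idxOf a < D.word.length :=
  List.idxOf_lt_length_iff.2 ha

theorem longArc_idxOf [Nonempty D.Under] (a : D.Under) : D.longArc (D.word.idxOf a.1) = a := by
  have h := D.idxOf_lt (D.under_mem a)
  exact Subtype.ext ((D.longArc_of_under h (by simpa using D.under_isOver a)).trans (by simp))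

/-- A row of the Jacobian matrix, applied to elements of a module. -/
theorem sum_jacobian_smul [Nonempty D.Under] (a : D.Under) (y : D.Under → Q) :
    ∑ b, D.jacobian a b • y b = (T (-(a.1.sign : ℤ)) : ℤ[T;T⁻¹]) • y a
      - y (D.longArc (D.word.idxOf a.1 + 1))
      + (1 - T (-(a.1.sign : ℤ)) : ℤ[T;T⁻¹]) •
        y (D.longArc (D.word.idxOf a.1.partner + 1)) := by
  have h (c : GaussLetter) (b : D.Under) :
      D.nextUnder c = some b.1 ↔ D.longArc (D.word.idxOf c + 1) = b := by
    have : D.nextUnder c = firstUnder D.word (D.word.idxOf c + 1) := rfl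
    rw [this, firstUnder_eq_longArc, Option.some_inj, Subtype.ext_iff]
  simp only [jacobian, h, add_smul, Finset.sum_add_distrib, ite_smul, zero_smul,
    Finset.sum_ite_eq, Finset.sum_ite_eq', Finset.mem_univ, if_true, neg_smul, one_smul]
  rw [sub_eq_add_neg (T _ • y a)]

/-- The colour of an over-strand is read off at the over-passage of its crossing, which is unique;
the default value zero takes care of the unused labels. -/
theorem exists_isColoring {c : ℕ → Q} (hN : c D.word.length = c 0)
    (hover : ∀ (k : ℕ) (hk : k < D.word.length), D.word[k].isOver = true → c (k + 1) = c k)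
    (hunder : ∀ (k : ℕ) (hk : k < D.word.length), D.word[k].isOver = false →
      c (k + 1) = (T (-(D.word[k].sign : ℤ)) : ℤ[T;T⁻¹]) • c k
        + (1 - T (-(D.word[k].sign : ℤ)) : ℤ[T;T⁻¹]) • c (D.word.idxOf D.word[k].partner)) :
    ∃ o : ℕ → Q, IsColoring D.word o (c 0) ∧
      ∀ k ≤ D.word.length, state D.word o (c 0) k = c k := by
  classical
  let o : ℕ → Q := fun l =>
    if h : ∃ a ∈ D.word, a.isOver = true ∧ a.label = l then c (D.word.idxOf h.choose) else 0
  have ho : ∀ a ∈ D.word, a.isOver = true → o a.label = c (D.word.idxOf a) := by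
    intro a ha hao
    have h : ∃ b ∈ D.word, b.isOver = true ∧ b.label = a.label := ⟨a, ha, hao, rfl⟩
    have hs := h.choose_spec
    simp only [o, dif_pos h]
    rw [D.eq_of_label_eq hs.1 ha hs.2.2 (hs.2.1.trans hao.symm)]
  have hstate : ∀ k ≤ D.word.length, state D.word o (c 0) k = c k := by
    intro k
    induction k with
    | zero => exact fun _ => state_zero _ _ _
    | succ k ih =>
      intro hk
      have hk' : k < D.word.length := hk
      rw [state_succ hk', ih hk'.le, step]
      split_ifs with hov
      · exact (hover k hk' hov).symm
      · have hov' : D.word[k].isOver = false := by simpa using hov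
        rw [hunder k hk' hov']
        have hp := D.partner_mem _ (List.getElem_mem hk')
        have := ho _ hp (by simp [GaussLetter.partner, hov'])
        rw [← this]
        rfl
  refine ⟨o, ⟨?_, ?_, ?_⟩, hstate⟩
  · rw [consistent_iff]
    intro k hk hov
    rw [hstate k hk.le, ho _ (List.getElem_mem hk) hov, D.nodup.idxOf_getElem]
  · rw [← state_length, hstate _ le_rfl, hN]
  · intro l hl
    refine dif_neg ?_
    rintro ⟨a, ha, -, hal⟩
    exact hl a ha hal

/-- The generator of the Alexander module that corresponds to a long arc. -/
noncomputable def arcGen (a : D.Under) : AlexanderModule D.word :=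
  state D.word (univOver D.word) (univBase D.word) (D.word.idxOf a.1)

theorem state_univ_eq_arcGen [Nonempty D.Under] {k : ℕ} (hk : k ≤ D.word.length) :
    state D.word (univOver D.word) (univBase D.word) k = D.arcGen (D.longArc k) :=
  state_eq_of_firstUnder D.nodup (isColoring_univ D.word).closed hk (D.firstUnder_eq_longArc k)

theorem univOver_eq_arcGen [Nonempty D.Under] {a : GaussLetter} (ha : a ∈ D.word)
    (ho : a.isOver = true) :
    univOver D.word a.label = D.arcGen (D.longArc (D.word.idxOf a)) := by
  have hk := D.idxOf_lt ha
  have := consistent_iff.1 (isColoring_univ D.word).consistent _ hk (by simpa using ho)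
  rw [← D.state_univ_eq_arcGen hk.le, ← this]
  simp

theorem partner_of_under (a : D.Under) :
    a.1.partner ∈ D.word ∧ a.1.partner.isOver = true :=
  ⟨D.partner_mem _ (D.under_mem a), by simp [GaussLetter.partner, D.under_isOver a]⟩

theorem longArc_idxOf_partner [Nonempty D.Under] (a : D.Under) :
    D.longArc (D.word.idxOf a.1.partner + 1) = D.longArc (D.word.idxOf a.1.partner) :=
  D.longArc_of_over (D.idxOf_lt (D.partner_of_under a).1)
    (by simpa using (D.partner_of_under a).2)

theorem sum_jacobian_smul_arcGen [Nonempty D.Under] (a : D.Under) :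
    ∑ b, D.jacobian a b • D.arcGen b = 0 := by
  have hk := D.idxOf_lt (D.under_mem a)
  have h1 := state_succ hk (univOver D.word) (univBase D.word)
  rw [D.state_univ_eq_arcGen hk.le, D.state_univ_eq_arcGen (Nat.succ_le_of_lt hk), step,
    longArc_idxOf] at h1
  simp only [List.getElem_idxOf, D.under_isOver a, Bool.false_eq_true, if_false] at h1
  have h2 := D.univOver_eq_arcGen (D.partner_of_under a).1 (D.partner_of_under a).2
  rw [sum_jacobian_smul, longArc_idxOf_partner, ← h2, h1]
  simp [GaussLetter.partner]

/-- The Jacobian matrix presents the Alexander module. -/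
theorem isPresentation_jacobian [Nonempty D.Under] :
    D.jacobian.IsPresentation D.arcGen where
  span_eq_top := by
    refine eq_top_of_mem (fun l => ?_) ?_
    · by_cases h : ∃ a ∈ D.word, a.label = l
      · obtain ⟨a, ha, rfl⟩ := h
        by_cases hao : a.isOver = true
        · rw [D.univOver_eq_arcGen ha hao]
          exact Submodule.subset_span ⟨_, rfl⟩
        · have := D.univOver_eq_arcGen (D.partner_mem a ha) (by simpa [GaussLetter.partner] using hao)
          have h2 : a.partner.label = a.label := rfl
          rw [← h2, this]
          exact Submodule.subset_span ⟨_, rfl⟩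
      · rw [(isColoring_univ D.word).eq_zero l (by simpa using h)]
        exact Submodule.zero_mem _
    · rw [← state_zero D.word (univOver D.word) (univBase D.word),
        D.state_univ_eq_arcGen (Nat.zero_le _)]
      exact Submodule.subset_span ⟨_, rfl⟩
  relation_iff r := by
    constructor
    · intro hr
      -- A family that satisfies the rows of the matrix is a colouring of the long arcs, hence the
      -- image of the universal one under a linear map. Every relation between the universal colours
      -- therefore holds for it.
      refine Matrix.exists_eq_vecMul_of_forall fun L x hrow => ?_
      obtain ⟨o, ho, hstate⟩ := D.exists_isColoring (c := fun k => x (D.longArc k))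
        (by rw [longArc_length])
        (fun k hk hko => by rw [D.longArc_of_over hk hko])
        (fun k hk hko => by
          have h := hrow (D.longArc k)
          rw [sum_jacobian_smul, longArc_idxOf_partner, D.longArc_of_under hk hko,
            D.nodup.idxOf_getElem] at h
          rw [sub_add_eq_add_sub, sub_eq_zero] at h
          exact h.symm)
      obtain ⟨f, hfo, hfq⟩ := exists_hom ho
      have hf : ∀ b, f (D.arcGen b) = x b := by
        intro b
        rw [arcGen, state, map_run, hfq, funext hfo]
        exact (hstate _ (D.idxOf_lt (D.under_mem b)).le).trans (by rw [longArc_idxOf])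
      simp only [← hf, ← map_smul, ← map_sum, hr, map_zero]
    · rintro ⟨c, rfl⟩
      simp only [Matrix.vecMul, dotProduct, Finset.sum_smul, mul_smul]
      rw [Finset.sum_comm]
      simp only [← Finset.smul_sum, sum_jacobian_smul_arcGen, smul_zero, Finset.sum_const_zero]

end GaussCode

/-! ### The first elementary ideal -/

namespace GaussCode

open LaurentPolynomial GaussWord

variable (D : GaussCode)

theorem firstElementaryIdeal_eq_adjugateIdeal [Nonempty D.Under] :
    D.firstElementaryIdeal = D.jacobian.adjugateIdeal :=
  Matrix.span_det_submatrix_eq_adjugateIdeal _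

theorem firstElementaryIdeal_of_isEmpty [IsEmpty D.Under] : D.firstElementaryIdeal = ⊤ := by
  rw [Ideal.eq_top_iff_one]
  have h0 : Fintype.card D.Under - 1 = 0 := by simp
  have : IsEmpty (Fin (Fintype.card D.Under - 1)) := by rw [h0]; infer_instance
  refine Ideal.subset_span ⟨fun i => isEmptyElim i, fun i => isEmptyElim i, ?_⟩
  rw [Matrix.det_isEmpty]

theorem word_eq_nil_of_isEmpty [IsEmpty D.Under] : D.word = [] := by
  rw [List.eq_nil_iff_forall_not_mem]
  intro a ha
  have h : ∀ b ∈ D.word, b.isOver ≠ false := fun b hb hbo =>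
    isEmptyElim (⟨b, Finset.mem_filter.2 ⟨List.mem_toFinset.2 hb, hbo⟩⟩ : D.Under)
  have h1 := h a ha
  have h2 := h _ (D.partner_mem a ha)
  simp only [GaussLetter.partner] at h2
  cases hao : a.isOver <;> simp_all

/-- Without crossings the module is free of rank one. The `1 × 1` zero matrix, whose adjugate is
`1`, stands in for the empty Jacobian, so that crossingless diagrams can be compared with all
others. -/
theorem isPresentation_of_isEmpty [IsEmpty D.Under] :
    (0 : Matrix Unit Unit ℤ[T;T⁻¹]).IsPresentation (fun _ => univBase D.word) where
  span_eq_top := by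
    refine eq_top_of_mem (fun l => ?_) (Submodule.subset_span ⟨(), rfl⟩)
    rw [(isColoring_univ D.word).eq_zero l (by simp [D.word_eq_nil_of_isEmpty])]
    exact Submodule.zero_mem _
  relation_iff r := by
    have hc : IsColoring D.word (fun _ => (0 : ℤ[T;T⁻¹])) 1 := by
      rw [D.word_eq_nil_of_isEmpty]
      exact ⟨consistent_nil _ _, rfl, fun _ _ => rfl⟩
    obtain ⟨f, -, hf⟩ := exists_hom hc
    constructor
    · intro h
      have h' := congrArg f h
      simp only [Finset.univ_unique, Finset.sum_singleton, map_smul, hf, map_zero] at h'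
      refine ⟨0, funext fun _ => ?_⟩
      simpa using h'
    · rintro ⟨c, rfl⟩
      simp

theorem firstElementaryIdeal_eq_of_knot_eq {D D' : GaussCode} (h : D.knot = D'.knot) :
    D.firstElementaryIdeal = D'.firstElementaryIdeal := by
  obtain ⟨e⟩ := equiv_of_knot_eq h
  have h0 : (0 : Matrix Unit Unit ℤ[T;T⁻¹]).adjugateIdeal = ⊤ :=
    Matrix.adjugateIdeal_of_unique _
  rcases isEmpty_or_nonempty D.Under with hD | hD <;>
    rcases isEmpty_or_nonempty D'.Under with hD' | hD'
  · rw [firstElementaryIdeal_of_isEmpty, firstElementaryIdeal_of_isEmpty]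
  · rw [firstElementaryIdeal_of_isEmpty, firstElementaryIdeal_eq_adjugateIdeal, ← h0]
    exact (D.isPresentation_of_isEmpty.map e).adjugateIdeal_eq D'.isPresentation_jacobian
  · rw [D'.firstElementaryIdeal_of_isEmpty, firstElementaryIdeal_eq_adjugateIdeal, ← h0]
    exact (D.isPresentation_jacobian.map e).adjugateIdeal_eq D'.isPresentation_of_isEmpty
  · rw [firstElementaryIdeal_eq_adjugateIdeal, firstElementaryIdeal_eq_adjugateIdeal]
    exact (D.isPresentation_jacobian.map e).adjugateIdeal_eq D'.isPresentation_jacobian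

/-! ### The value of the elementary ideal at one -/

/-- Evaluation of Laurent polynomials at one. -/
noncomputable def evalOne : ℤ[T;T⁻¹] →+* ℤ := LaurentPolynomial.eval₂ (RingHom.id ℤ) 1

@[simp] theorem evalOne_T (n : ℤ) : evalOne (T n) = 1 := by
  simp [evalOne]

/-- At `T = 1` the over-strand drops out of the crossing relation. The formula follows by viewing
`C` as a module on which `T` acts trivially. -/
theorem sum_jacobian_evalOne_smul {C : Type*} [AddCommGroup C] [Nonempty D.Under]
    (a : D.Under) (y : D.Under → C) :
    ∑ b, evalOne (D.jacobian a b) • y b = y a - y (D.longArc (D.word.idxOf a.1 + 1)) := by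
  let _ : Module ℤ[T;T⁻¹] C := Module.compHom C evalOne
  have h : ∀ (r : ℤ[T;T⁻¹]) (c : C), r • c = evalOne r • c := fun _ _ => rfl
  have := D.sum_jacobian_smul a y
  simpa only [h, map_sub, map_one, evalOne_T, one_smul, sub_self, zero_smul, add_zero] using this

/-- The relations at `T = 1` identify consecutive long arcs, and since the diagram is one closed
curve, all arcs become equal: the module is `ℤ`. -/
theorem isPresentation_evalOne [Nonempty D.Under] :
    (D.jacobian.map evalOne).IsPresentation (fun _ => (1 : ℤ)) where
  span_eq_top := by
    rw [Set.range_const]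
    exact Ideal.span_singleton_one
  relation_iff r := by
    constructor
    · intro hr
      refine Matrix.exists_eq_vecMul_of_forall fun L x hrow => ?_
      have hconst : ∀ k ≤ D.word.length, x (D.longArc k) = x (D.longArc 0) := by
        intro k
        induction k with
        | zero => exact fun _ => rfl
        | succ k ih =>
          intro hk
          have hk' : k < D.word.length := hk
          rw [← ih hk'.le]
          by_cases ho : D.word[k].isOver = true
          · rw [D.longArc_of_over hk' ho]
          · have h := hrow (D.longArc k)
            simp only [Matrix.map_apply] at h
            rw [sum_jacobian_evalOne_smul, D.longArc_of_under hk' (by simpa using ho),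
              D.nodup.idxOf_getElem, sub_eq_zero] at h
            exact h.symm
      have hx : ∀ b, x b = x (D.longArc 0) := by
        intro b
        rw [← hconst _ (D.idxOf_lt (D.under_mem b)).le, longArc_idxOf]
      simp only [hx]
      rw [← Finset.sum_smul]
      simp only [smul_eq_mul, mul_one] at hr
      rw [hr, zero_smul]
    · rintro ⟨c, rfl⟩
      have h := fun a => D.sum_jacobian_evalOne_smul a (fun _ => (1 : ℤ))
      simp only [Matrix.vecMul, dotProduct, Finset.sum_smul, mul_smul, Matrix.map_apply]
      rw [Finset.sum_comm]
      simp only [← Finset.smul_sum, h, sub_self, smul_zero, Finset.sum_const_zero]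

/-- The group `ℤ` is also presented by the `1 × 1` zero matrix, whose adjugate ideal is everything.
For principal ideals this gives the classical value `±1` of the Alexander polynomial at one. -/
theorem map_evalOne_firstElementaryIdeal : D.firstElementaryIdeal.map evalOne = ⊤ := by
  rcases isEmpty_or_nonempty D.Under with hD | hD
  · rw [firstElementaryIdeal_of_isEmpty, Ideal.map_top]
  · rw [firstElementaryIdeal_eq_adjugateIdeal, ← Matrix.adjugateIdeal_map]
    have h : (0 : Matrix Unit Unit ℤ).IsPresentation (fun _ => (1 : ℤ)) :=
      ⟨by rw [Set.range_const]; exact Ideal.span_singleton_one, fun r => by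
        constructor
        · intro h
          exact ⟨0, funext fun _ => by simpa using h⟩
        · rintro ⟨c, rfl⟩
          simp⟩
    rw [D.isPresentation_evalOne.adjugateIdeal_eq h, Matrix.adjugateIdeal_of_unique]

/-! ### Alexander numberable codes -/

theorem longArc_idxOf_next [Nonempty D.Under] {a : GaussLetter} (ha : a ∈ D.word) :
    D.longArc (D.word.idxOf (D.word.next a ha)) = D.longArc (D.word.idxOf a + 1) := by
  have hlt := D.idxOf_lt ha
  rw [List.next_eq_getElem, D.nodup.idxOf_getElem]
  rcases Nat.lt_or_ge (D.word.idxOf a + 1) D.word.length with h | h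
  · rw [Nat.mod_eq_of_lt h]
  · have : D.word.idxOf a + 1 = D.word.length := by omega
    rw [this, Nat.mod_self, longArc_length]

theorem sum_next {A : Type*} [AddCommMonoid A] (f : GaussLetter → A) :
    ∑ a : {a // a ∈ D.word.toFinset}, f (D.word.next a.1 (List.mem_toFinset.1 a.2))
      = ∑ a : {a // a ∈ D.word.toFinset}, f a.1 := by
  let e : {a // a ∈ D.word.toFinset} → {a // a ∈ D.word.toFinset} := fun a =>
    ⟨D.word.next a.1 (List.mem_toFinset.1 a.2), List.mem_toFinset.2 (List.next_mem _ _ _)⟩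
  have he : Function.Surjective e := by
    rintro ⟨a, ha⟩
    refine ⟨⟨D.word.prev a (List.mem_toFinset.1 ha), List.mem_toFinset.2 (List.prev_mem _ _ _)⟩, ?_⟩
    exact Subtype.ext (List.next_prev _ D.nodup _ _)
  exact Fintype.sum_bijective e (Finite.surjective_iff_bijective.1 he) _ _ fun _ => rfl

theorem sum_passages {A : Type*} [AddCommMonoid A] (f : {a // a ∈ D.word.toFinset} → A) :
    ∑ a, f a = ∑ a : D.Under, (f ⟨a.1, List.mem_toFinset.2 (D.under_mem a)⟩
      + f ⟨a.1.partner, List.mem_toFinset.2 (D.partner_of_under a).1⟩) := by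
  rw [Finset.sum_add_distrib, ← Finset.sum_filter_add_sum_filter_not Finset.univ
    (fun a : {a // a ∈ D.word.toFinset} => a.1.isOver = false)]
  congr 1
  · refine (Finset.sum_bij (fun (a : D.Under) _ => ⟨a.1, List.mem_toFinset.2 (D.under_mem a)⟩)
      ?_ ?_ ?_ fun _ _ => rfl).symm
    · intro a _
      simpa using D.under_isOver a
    · intro a _ b _ h
      exact Subtype.ext (Subtype.mk.inj h)
    · intro a ha
      exact ⟨⟨a.1, Finset.mem_filter.2 ⟨a.2, (Finset.mem_filter.1 ha).2⟩⟩, Finset.mem_univ _, rfl⟩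
  · refine (Finset.sum_bij (fun (a : D.Under) _ => ⟨a.1.partner, List.mem_toFinset.2
      (D.partner_of_under a).1⟩) ?_ ?_ ?_ fun _ _ => rfl).symm
    · intro a _
      simp [(D.partner_of_under a).2]
    · intro a _ b _ h
      have h' : a.1.partner = b.1.partner := congrArg Subtype.val h
      apply Subtype.ext
      have := congrArg GaussLetter.partner h'
      exact GaussLetter.ext_iff.2 (by simpa [GaussLetter.partner] using this)
    · intro a ha
      have hp := D.partner_mem a.1 (List.mem_toFinset.1 a.2)
      have ho : a.1.isOver = true := by simpa using (Finset.mem_filter.1 ha).2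
      refine ⟨⟨a.1.partner, Finset.mem_filter.2 ⟨List.mem_toFinset.2 hp, ?_⟩⟩,
        Finset.mem_univ _, Subtype.ext ?_⟩
      · simp [GaussLetter.partner, ho]
      · simp [GaussLetter.partner]

theorem jacobian_mulVec_one [Nonempty D.Under] : D.jacobian.mulVec 1 = 0 := by
  refine funext fun a => ?_
  have := D.sum_jacobian_smul a (fun _ => (1 : ℤ[T;T⁻¹]))
  simp only [smul_eq_mul, mul_one] at this
  simp only [Matrix.mulVec, dotProduct, Pi.one_apply, mul_one, this, Pi.zero_apply]
  ring

/-- Give each short arc the weight `T ^ num` times the variable of its long arc. Multiplied by `T ^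
(m + ε)`, the relation of a crossing is the weight of the two incoming short arcs minus that of the
two outgoing ones. Every short arc comes in once and goes out once, so the sum over all crossings
cancels. -/
theorem vecMul_jacobian_of_numbering [Nonempty D.Under] {num : GaussLetter → ℤ}
    (h : ∀ (a : GaussLetter) (ha : a ∈ D.word), a.isOver = false →
      num (D.word.next a.partner (D.partner_mem a ha)) = num a ∧
      num (D.word.next a ha) = num a.partner ∧
      num a.partner = num a + (a.sign : ℤ)) :
    Matrix.vecMul (fun a : D.Under => T (num a.1.partner)) D.jacobian = 0 := by
  have key : ∀ y : D.Under → ℤ[T;T⁻¹],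
      ∑ a : D.Under, T (num a.1.partner) * ∑ b, D.jacobian a b * y b = 0 := by
    intro y
    let G : GaussLetter → ℤ[T;T⁻¹] := fun a => T (num a) * y (D.longArc (D.word.idxOf a))
    have h1 : ∀ a : D.Under, T (num a.1.partner) * ∑ b, D.jacobian a b * y b
        = (G a.1 + G a.1.partner)
          - (G (D.word.next a.1 (D.under_mem a))
            + G (D.word.next a.1.partner (D.partner_of_under a).1)) := by
      intro a
      obtain ⟨h1, h2, h3⟩ := h a.1 (D.under_mem a) (D.under_isOver a)
      have hs := D.sum_jacobian_smul a y
      simp only [smul_eq_mul] at hs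
      have hT : (T (num a.1.partner) : ℤ[T;T⁻¹]) * T (-(a.1.sign : ℤ)) = T (num a.1) := by
        rw [← T_add, h3]
        congr 1
        ring
      simp only [G, h1, h2, hs, longArc_idxOf_next, longArc_idxOf, longArc_idxOf_partner]
      linear_combination (y a - y (D.longArc (D.word.idxOf a.1.partner))) * hT
    rw [Finset.sum_congr rfl fun a _ => h1 a, Finset.sum_sub_distrib, sub_eq_zero]
    rw [← D.sum_passages (fun a => G a.1),
      ← D.sum_passages (fun a => G (D.word.next a.1 (List.mem_toFinset.1 a.2))), D.sum_next G]
  refine funext fun b => ?_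
  have := key (Pi.single b 1)
  simpa [Matrix.vecMul, dotProduct, Pi.single_apply, mul_comm] using this

theorem exists_firstElementaryIdeal_eq_span_singleton (hD : D.IsAlexanderNumberable) :
    ∃ g, D.firstElementaryIdeal = Ideal.span {g} := by
  rcases isEmpty_or_nonempty D.Under with hU | hU
  · exact ⟨1, by rw [firstElementaryIdeal_of_isEmpty, Ideal.span_singleton_one]⟩
  · obtain ⟨num, hnum⟩ := hD
    rw [firstElementaryIdeal_eq_adjugateIdeal]
    exact Matrix.exists_adjugateIdeal_eq_span_singleton (fun a => isUnit_T _)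
      (D.vecMul_jacobian_of_numbering hnum) D.jacobian_mulVec_one

end GaussCode

/-- For an almost classical knot, the Alexander polynomial generates the first elementary ideal of
every diagram. -/
theorem VirtualKnot.IsAlexanderPolynomial.firstElementaryIdeal_eq {K : VirtualKnot}
    {Δ : ℤ[T;T⁻¹]} (hΔ : K.IsAlexanderPolynomial Δ) (hK : K.IsAlmostClassical) {D : GaussCode}
    (hD : D.knot = K) : D.firstElementaryIdeal = Ideal.span {Δ} := by
  obtain ⟨D₁, h₁, hnum⟩ := hK
  obtain ⟨D₂, h₂, hle, hmin⟩ := hΔ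
  obtain ⟨g, hg⟩ := D₁.exists_firstElementaryIdeal_eq_span_singleton hnum
  have h12 := GaussCode.firstElementaryIdeal_eq_of_knot_eq (h₁.trans h₂.symm)
  rw [GaussCode.firstElementaryIdeal_eq_of_knot_eq (hD.trans h₂.symm)]
  -- The ideal has a generator `g`, and the minimality of `Δ` among principal ideals applied to `g`
  -- makes the inclusion an equality.
  refine le_antisymm hle ?_
  have := hmin g (by rw [← h12, hg])
  rwa [← hg, h12] at this

/-! ### Block Toeplitz matrices and block circulant matrices in characteristic `p` -/

namespace Matrix

open scoped Kronecker

section Toeplitz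

variable {R : Type*} [CommRing R] {Ω : Type*} [Fintype Ω] [DecidableEq Ω] {n : ℕ}

/-- The upper triangular block Toeplitz matrix with given diagonals. -/
def blockToeplitz (n : ℕ) (t : ℕ → Matrix Ω Ω R) : Matrix (Fin n × Ω) (Fin n × Ω) R :=
  of fun x y => if x.1 ≤ y.1 then t (y.1 - x.1 : ℕ) x.2 y.2 else 0

theorem adjugateIdeal_submatrix_right {ι : Type*} [Fintype ι] [DecidableEq ι] (A : Matrix ι ι R)
    (σ : Equiv.Perm ι) : (A.submatrix id σ).adjugateIdeal = A.adjugateIdeal := by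
  have h : A.submatrix id σ = A * (1 : Matrix ι ι R).submatrix id σ := by
    ext i j
    simp [mul_apply, one_apply]
  rw [h, adjugateIdeal_mul_of_isUnit_det_right]
  rw [det_permute', det_one, mul_one]
  exact (Equiv.Perm.sign σ).isUnit.map (Int.castRingHom R)

/-- The cyclic shift of the columns `(i, b₀)`. -/
def columnShift (n : ℕ) (b₀ : Ω) : Equiv.Perm (Fin (n + 1) × Ω) :=
  Equiv.prodCongrLeft fun b => if b = b₀ then Equiv.addRight 1 else Equiv.refl _

/-- The block Toeplitz matrix after replacing the columns `(i, b₀)` by the sums of all columns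
`(i, b)` and shifting them. -/
def shiftedToeplitz (n : ℕ) (t : ℕ → Matrix Ω Ω R) (b₀ : Ω) :
    Matrix (Fin (n + 1) × Ω) (Fin (n + 1) × Ω) R :=
  (blockToeplitz (n + 1) t * (1 : Matrix (Fin (n + 1)) (Fin (n + 1)) R) ⊗ₖ
    ((1 : Matrix Ω Ω R).updateCol b₀ 1)).submatrix id (columnShift n b₀)

theorem adjugateIdeal_shiftedToeplitz (t : ℕ → Matrix Ω Ω R) (b₀ : Ω) :
    (shiftedToeplitz n t b₀).adjugateIdeal = (blockToeplitz (n + 1) t).adjugateIdeal := by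
  rw [shiftedToeplitz, adjugateIdeal_submatrix_right, adjugateIdeal_mul_of_isUnit_det_right]
  rw [det_kronecker, det_one_updateCol]
  simp

theorem shiftedToeplitz_apply_of_ne (t : ℕ → Matrix Ω Ω R) {b₀ b : Ω} (hb : b ≠ b₀)
    (i j : Fin (n + 1)) (a : Ω) :
    shiftedToeplitz n t b₀ (i, a) (j, b) = if i ≤ j then t (j - i : ℕ) a b else 0 := by
  simp only [shiftedToeplitz, columnShift, submatrix_apply, id, Equiv.prodCongrLeft_apply, hb,
    if_false, Equiv.refl_apply, mul_apply, Fintype.sum_prod_type, kroneckerMap_apply,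
    updateCol_ne hb, blockToeplitz, of_apply, one_apply]
  simp

theorem shiftedToeplitz_apply_self (t : ℕ → Matrix Ω Ω R) (b₀ : Ω) (i j : Fin (n + 1)) (a : Ω) :
    shiftedToeplitz n t b₀ (i, a) (j, b₀)
      = if i ≤ j + 1 then ∑ b, t ((j + 1 : Fin (n + 1)) - i : ℕ) a b else 0 := by
  simp only [shiftedToeplitz, columnShift, submatrix_apply, id, Equiv.prodCongrLeft_apply,
    if_true, Equiv.coe_addRight, mul_apply, Fintype.sum_prod_type, kroneckerMap_apply,
    updateCol_self, blockToeplitz, of_apply, one_apply, Pi.one_apply, mul_one]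
  rw [Finset.sum_comm]
  split_ifs with h <;> simp [h]

/-- The cyclic shift brings the column sums of block `0` to the last place. They vanish: below the
first block row by triangularity, inside it by the hypothesis on `t 0`. -/
theorem shiftedToeplitz_last {t : ℕ → Matrix Ω Ω R} (h0 : ∀ a, ∑ b, t 0 a b = 0) (b₀ : Ω)
    (x : Fin (n + 1) × Ω) : shiftedToeplitz n t b₀ x (Fin.last n, b₀) = 0 := by
  obtain ⟨i, a⟩ := x
  rw [shiftedToeplitz_apply_self, Fin.last_add_one]
  split_ifs with h
  · have : i = 0 := by simpa using h
    simp [this, h0]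
  · rfl

/-- The diagonal block of `shiftedToeplitz`. -/
def diagonalBlock (t : ℕ → Matrix Ω Ω R) (b₀ : Ω) : Matrix Ω Ω R :=
  (t 0).updateCol b₀ fun a => ∑ b, t 1 a b

/-- The summed column of block `j + 1` vanishes in row block `j + 1`, so its lowest possibly nonzero
part is given by the row sums of `t 1` in row block `j`. Moved to block `j` it keeps the matrix
block triangular and completes `t 0` to `diagonalBlock`. In the last block this column is zero, and
`v` takes its place. -/
theorem det_shiftedToeplitz_updateCol {t : ℕ → Matrix Ω Ω R} (h0 : ∀ a, ∑ b, t 0 a b = 0)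
    (b₀ : Ω) (v : Fin (n + 1) × Ω → R) :
    ((shiftedToeplitz n t b₀).updateCol (Fin.last n, b₀) v).det
      = (diagonalBlock t b₀).det ^ n *
        ((diagonalBlock t b₀).updateCol b₀ fun a => v (Fin.last n, a)).det := by
  set W := (shiftedToeplitz n t b₀).updateCol (Fin.last n, b₀) v with hW
  have htri : W.BlockTriangular Prod.fst := by
    rintro ⟨i, a⟩ ⟨j, b⟩ hij
    simp only at hij
    have hj : j ≠ Fin.last n := ne_of_lt (lt_of_lt_of_le hij (Fin.le_last i))
    rw [hW, updateCol_ne (by simp [hj])]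
    by_cases hb : b = b₀
    · subst hb
      rw [shiftedToeplitz_apply_self]
      have hj1 : ((j + 1 : Fin (n + 1)) : ℕ) = j + 1 := Fin.val_add_one_of_lt (Fin.lt_last_iff_ne_last.2 hj)
      split_ifs with h
      · rw [Fin.le_def, hj1] at h
        rw [Fin.lt_def] at hij
        have : ((j + 1 : Fin (n + 1)) - i : ℕ) = 0 := by omega
        rw [this, h0]
      · rfl
    · rw [shiftedToeplitz_apply_of_ne t hb, if_neg (not_le.2 hij)]
  have hblock : ∀ k, (W.toSquareBlock Prod.fst k).det
      = (of fun a b => W (k, a) (k, b) : Matrix Ω Ω R).det := by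
    intro k
    let e : Ω ≃ {x : Fin (n + 1) × Ω // x.1 = k} :=
      ⟨fun a => ⟨(k, a), rfl⟩, fun x => x.1.2, fun _ => rfl, by rintro ⟨⟨i, a⟩, rfl⟩; rfl⟩
    rw [← det_submatrix_equiv_self e]
    rfl
  rw [htri.det_fintype]
  simp only [hblock]
  rw [Fin.prod_univ_castSucc]
  congr 1
  · have hk : ∀ k : Fin n, (of fun a b => W (k.castSucc, a) (k.castSucc, b) : Matrix Ω Ω R)
        = diagonalBlock t b₀ := by
      intro k
      ext a b
      rw [of_apply, hW, updateCol_ne (by simp [(Fin.castSucc_lt_last k).ne]), diagonalBlock]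
      by_cases hb : b = b₀
      · subst hb
        rw [shiftedToeplitz_apply_self, updateCol_self]
        simp [Fin.le_def]
      · rw [shiftedToeplitz_apply_of_ne t hb, updateCol_ne hb]
        simp
    simp [hk]
  · congr 1
    ext a b
    rw [of_apply, hW]
    by_cases hb : b = b₀
    · subst hb
      rw [updateCol_self, updateCol_self]
    · rw [updateCol_ne (by simp [hb]), updateCol_ne hb, diagonalBlock, updateCol_ne hb,
        shiftedToeplitz_apply_of_ne t hb]
      simp

/-- The codimension one minors of a block Toeplitz matrix whose diagonal block has vanishing row
sums. -/
theorem exists_dvd_adjugate_blockToeplitz [Nonempty Ω] (n : ℕ) {t : ℕ → Matrix Ω Ω R}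
    (h0 : ∀ a, ∑ b, t 0 a b = 0) :
    ∃ d, (blockToeplitz (n + 1) t).adjugateIdeal ≤ Ideal.span {d ^ n} ∧
      d ^ (n + 1) ∈ (blockToeplitz (n + 1) t).adjugateIdeal := by
  obtain ⟨b₀⟩ := ‹Nonempty Ω›
  refine ⟨(diagonalBlock t b₀).det, ?_⟩
  rw [← adjugateIdeal_shiftedToeplitz t b₀]
  have hcr : ∀ v : Fin (n + 1) × Ω → R,
      ((shiftedToeplitz n t b₀).adjugate *ᵥ v) (Fin.last n, b₀)
        = (diagonalBlock t b₀).det ^ n *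
        ((diagonalBlock t b₀).updateCol b₀ fun a => v (Fin.last n, a)).det := by
    intro v
    rw [← det_shiftedToeplitz_updateCol h0, ← cramer_apply, cramer_eq_adjugate_mulVec]
  constructor
  · rw [adjugateIdeal_le_iff]
    intro x y
    by_cases hx : x = (Fin.last n, b₀)
    · subst hx
      have := hcr (Pi.single y 1)
      rw [mulVec_single_one] at this
      rw [Ideal.mem_span_singleton]
      exact ⟨_, this⟩
    -- In every other row of the adjugate the cofactors still contain the zero column.
    · have : (shiftedToeplitz n t b₀).adjugate x y = 0 := by
        rw [adjugate_apply]
        refine det_eq_zero_of_column_eq_zero (Fin.last n, b₀) fun k => ?_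
        rcases eq_or_ne k y with rfl | hk
        · simp [Ne.symm hx]
        · rw [updateRow_ne hk, shiftedToeplitz_last h0]
      rw [this]
      exact Ideal.zero_mem _
  -- Filling the zero column with the row sums of `t 1` turns the last diagonal block into one more
  -- copy of `diagonalBlock`, whence the exponent `n + 1`.
  · have := hcr fun x => ∑ b, t 1 x.2 b
    have h2 : (diagonalBlock t b₀).updateCol b₀ (fun a => ∑ b, t 1 a b) = diagonalBlock t b₀ := by
      rw [diagonalBlock, updateCol_idem]
    rw [h2, ← pow_succ] at this
    rw [← this, mulVec, dotProduct]
    exact Ideal.sum_mem _ fun y _ => Ideal.mul_mem_right _ _ (adjugate_mem_adjugateIdeal _ _ _)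

end Toeplitz

/-! ### Matrices with a free symmetry of order `p` in characteristic `p` -/

section Circulant

universe u

variable {R : Type*} [CommRing R] {p : ℕ} [hp : Fact p.Prime] [CharP R p]

/-- By Vandermonde's identity, since `p` divides the inner binomial coefficients of `p`. Hence `j ↦
j.choose i` is a function on `ℤ / p`, which permits binomials as a basis for block circulant
matrices. -/
theorem cast_choose_add_prime (j : ℕ) {i : ℕ} (hi : i < p) :
    ((j + p).choose i : R) = (j.choose i : R) := by
  rw [Nat.add_choose_eq, Finset.Nat.sum_antidiagonal_eq_sum_range_succ
    (fun a b => j.choose a * p.choose b), Finset.sum_range_succ]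
  push_cast
  rw [Finset.sum_eq_zero]
  · simp
  · intro k hk
    have hk' := Finset.mem_range.1 hk
    have h : p ∣ p.choose (i - k) := hp.out.dvd_choose_self (by omega) (by omega)
    rw [(CharP.cast_eq_zero_iff R p _).2 h, mul_zero]

theorem sum_range_add_of_periodic {A : Type*} [AddCommGroup A] {f : ℕ → A} {N : ℕ}
    (hf : ∀ k, f (k + N) = f k) (i : ℕ) :
    ∑ k ∈ Finset.range N, f (k + i) = ∑ k ∈ Finset.range N, f k := by
  induction i with
  | zero => rfl
  | succ i ih =>
    rw [← ih]
    have h1 := Finset.sum_range_succ (fun k => f (k + i)) N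
    have h2 := Finset.sum_range_succ' (fun k => f (k + i)) N
    rw [h1] at h2
    have h3 : f (N + i) = f (0 + i) := by rw [add_comm N, hf, zero_add]
    rw [h3] at h2
    have h4 := add_right_cancel h2
    rw [h4]
    refine Finset.sum_congr rfl fun k _ => ?_
    congr 1
    ring

variable {ι : Type*} [Fintype ι] [DecidableEq ι] {Ω : Type*} [Fintype Ω] [DecidableEq Ω]

/-- Cyclic shifts become unipotent in the basis of binomial functions: the shift by `k` is the sum
of `k.choose m` times the `m`-th power of a nilpotent Jordan block. The change of basis `C` is
unitriangular, hence invertible over any ring. -/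
theorem adjugateIdeal_eq_blockToeplitz {A : Matrix ι ι R} {τ : Equiv.Perm ι}
    (hA : ∀ i j, A (τ i) (τ j) = A i j) (hτ : τ ^ p = 1) (r : Ω → ι) (e : Fin p × Ω ≃ ι)
    (he : ∀ x, e x = (τ ^ (x.1 : ℕ)) (r x.2)) :
    A.adjugateIdeal = (blockToeplitz p fun m => of fun a b =>
      ∑ k ∈ Finset.range p, (k.choose m : R) * A (r a) ((τ ^ k) (r b))).adjugateIdeal := by
  have hA' : ∀ (k : ℕ) i j, A ((τ ^ k) i) ((τ ^ k) j) = A i j := by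
    intro k
    induction k with
    | zero => simp
    | succ k ih =>
      intro i j
      rw [pow_succ', Equiv.Perm.mul_apply, Equiv.Perm.mul_apply, hA, ih]
  set Tm : ℕ → Matrix Ω Ω R := fun m => of fun a b =>
      ∑ k ∈ Finset.range p, (k.choose m : R) * A (r a) ((τ ^ k) (r b)) with hTm
  let C : Matrix (Fin p) (Fin p) R := of fun j i => ((j : ℕ).choose i : R)
  have hC : C.det = 1 := by
    rw [det_of_isLowerTriangular C]
    · simp [C]
    · intro i j hij
      have : (i : ℕ) < j := hij
      simp [C, Nat.choose_eq_zero_of_lt this]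
  have key : A.submatrix e e * (C ⊗ₖ (1 : Matrix Ω Ω R))
      = (C ⊗ₖ (1 : Matrix Ω Ω R)) * blockToeplitz p Tm := by
    ext ⟨i, a⟩ ⟨m, b⟩
    have hl : (A.submatrix e e * (C ⊗ₖ (1 : Matrix Ω Ω R))) (i, a) (m, b)
        = ∑ j ∈ Finset.range p, A ((τ ^ (i : ℕ)) (r a)) ((τ ^ j) (r b)) * (j.choose m : R) := by
      rw [mul_apply, Fintype.sum_prod_type, Finset.sum_range]
      refine Finset.sum_congr rfl fun j _ => ?_
      simp [he, C, one_apply]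
    have hr : ((C ⊗ₖ (1 : Matrix Ω Ω R)) * blockToeplitz p Tm) (i, a) (m, b)
        = ∑ l ∈ Finset.range (m + 1), ((i : ℕ).choose l : R) * Tm (m - l) a b := by
      have : ∑ l ∈ Finset.range (m + 1), ((i : ℕ).choose l : R) * Tm (m - l) a b
          = ∑ l ∈ Finset.range p,
            ((i : ℕ).choose l : R) * if l ≤ m then Tm (m - l) a b else 0 := by
        have hm := m.2
        have hs : Finset.range ((m : ℕ) + 1) ⊆ Finset.range p :=
          Finset.range_subset_range.2 (by omega)
        rw [← Finset.sum_subset hs]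
        · refine Finset.sum_congr rfl fun l hl => ?_
          rw [if_pos (Nat.lt_succ_iff.1 (Finset.mem_range.1 hl))]
        · intro l _ hl
          rw [if_neg (by simpa [Nat.lt_succ_iff] using hl), mul_zero]
      rw [this, mul_apply, Fintype.sum_prod_type, Finset.sum_range]
      refine Finset.sum_congr rfl fun j _ => ?_
      simp only [kroneckerMap_apply, one_apply, blockToeplitz, of_apply, C, mul_ite, mul_one,
        mul_zero, ite_mul, zero_mul, Fin.le_def]
      split_ifs <;> simp
    rw [hl, hr]
    -- The summand is `p`-periodic in `j`, so the sum may start at `i`; invariance under `τ ^ i` and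
    -- Vandermonde's identity for `(i + k).choose m` then give the product with the Toeplitz matrix.
    rw [← sum_range_add_of_periodic (f := fun j =>
      A ((τ ^ (i : ℕ)) (r a)) ((τ ^ j) (r b)) * (j.choose m : R)) (N := p) _ i]
    · simp only [hTm, of_apply, Finset.mul_sum]
      rw [Finset.sum_comm]
      refine Finset.sum_congr rfl fun k _ => ?_
      rw [add_comm k, pow_add, Equiv.Perm.mul_apply, hA', Nat.add_choose_eq,
        Finset.Nat.sum_antidiagonal_eq_sum_range_succ
          (fun x y => (i : ℕ).choose x * k.choose y)]
      push_cast
      rw [Finset.mul_sum]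
      refine Finset.sum_congr rfl fun l _ => ?_
      ring
    · intro j
      rw [pow_add, hτ, mul_one, cast_choose_add_prime j m.2]
  have hu : IsUnit (C ⊗ₖ (1 : Matrix Ω Ω R)).det := by
    rw [det_kronecker, hC]
    simp
  rw [← adjugateIdeal_submatrix_equiv A e, ← adjugateIdeal_mul_of_isUnit_det_right _ hu, key,
    adjugateIdeal_mul_of_isUnit_det_left _ hu]

/-- A point fixed by `τ ^ k` and by `τ ^ p` with `k` and `p` coprime would be fixed by `τ`. -/
theorem pow_apply_ne {ι : Type*} {τ : Equiv.Perm ι} (hτ : τ ^ p = 1) (hfix : ∀ i, τ i ≠ i) {k : ℕ}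
    (hk : 0 < k) (hkp : k < p) (i : ι) : (τ ^ k) i ≠ i := by
  intro h
  have h1 : Function.IsPeriodicPt τ k i := by
    rw [Function.IsPeriodicPt, ← Equiv.Perm.coe_pow]
    exact h
  have h2 : Function.IsPeriodicPt τ p i := by
    rw [Function.IsPeriodicPt, ← Equiv.Perm.coe_pow, hτ]
    rfl
  have h3 := h2.gcd h1
  rw [Nat.Coprime.gcd_eq_one (Nat.coprime_of_lt_prime hk.ne' hkp hp.out)] at h3
  exact hfix i h3

/-- A free permutation of order `p` splits a finite type into `p` copies of the set of orbits. -/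
theorem exists_orbit_equiv {ι : Type u} [Fintype ι] [DecidableEq ι] {τ : Equiv.Perm ι} (hτ : τ ^ p = 1) (hfix : ∀ i, τ i ≠ i) :
    ∃ (Ω : Type u) (_ : Fintype Ω) (_ : DecidableEq Ω) (r : Ω → ι) (e : Fin p × Ω ≃ ι),
      ∀ x, e x = (τ ^ (x.1 : ℕ)) (r x.2) := by
  classical
  let s := Equiv.Perm.SameCycle.setoid τ
  refine ⟨Quotient s, Fintype.ofFinite _, Classical.decEq _, Quotient.out,
    Equiv.ofBijective (fun x : Fin p × Quotient s => (τ ^ (x.1 : ℕ)) (Quotient.out x.2)) ⟨?_, ?_⟩,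
    fun x => rfl⟩
  · rintro ⟨i, c⟩ ⟨j, c'⟩ h
    simp only at h
    have hcc : c = c' := by
      rw [← Quotient.out_eq c, ← Quotient.out_eq c']
      apply Quotient.sound
      change τ.SameCycle _ _
      have h1 : τ.SameCycle ((τ ^ (i : ℕ)) c.out) ((τ ^ (j : ℕ)) c'.out) := by rw [h]
      simpa using h1
    subst hcc
    have hij : ∀ i j : Fin p, (τ ^ (i : ℕ)) c.out = (τ ^ (j : ℕ)) c.out → ¬ i < j := by
      intro i j h hlt
      have hlt' : (i : ℕ) < j := hlt
      have hd : (j : ℕ) = i + (j - i) := by omega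
      rw [hd, pow_add, Equiv.Perm.mul_apply] at h
      exact pow_apply_ne hτ hfix (by omega) (by omega) _ ((τ ^ (i : ℕ)).injective h).symm
    rcases lt_trichotomy i j with hlt | rfl | hlt
    · exact absurd hlt (hij i j h)
    · rfl
    · exact absurd hlt (hij j i h.symm)
  · intro x
    have h : τ.SameCycle (Quotient.out (Quotient.mk s x)) x := @Quotient.exact _ s _ _ (Quotient.out_eq _)
    obtain ⟨k, hk⟩ := h.exists_nat_pow_eq
    refine ⟨(⟨k % p, Nat.mod_lt _ hp.out.pos⟩, Quotient.mk s x), ?_⟩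
    simp only
    conv_rhs => rw [← hk, ← Nat.mod_add_div k p, pow_add, pow_mul, hτ, one_pow, mul_one]

/-- The codimension one minors of a matrix in characteristic `p` that has vanishing row sums and
is invariant under a free permutation of order `p` of its indices. -/
theorem exists_adjugateIdeal_le_of_invariant [Nonempty ι] {A : Matrix ι ι R} {τ : Equiv.Perm ι}
    (hA : ∀ i j, A (τ i) (τ j) = A i j) (hτ : τ ^ p = 1) (hfix : ∀ i, τ i ≠ i)
    (h1 : A *ᵥ 1 = 0) :
    ∃ d, A.adjugateIdeal ≤ Ideal.span {d ^ (p - 1)} ∧ d ^ p ∈ A.adjugateIdeal := by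
  obtain ⟨Ω, _, _, r, e, he⟩ := exists_orbit_equiv hτ hfix
  have : Nonempty Ω := by
    obtain ⟨i⟩ := ‹Nonempty ι›
    exact ⟨(e.symm i).2⟩
  rw [adjugateIdeal_eq_blockToeplitz hA hτ r e he]
  obtain ⟨n, rfl⟩ := Nat.exists_eq_succ_of_ne_zero hp.out.ne_zero
  -- Since `k.choose 0 = 1`, the row sums of the block with index `0` are row sums of `A`, grouped
  -- by orbits.
  exact exists_dvd_adjugate_blockToeplitz n (t := fun m => of fun a b =>
      ∑ k ∈ Finset.range (n + 1), (k.choose m : R) * A (r a) ((τ ^ k) (r b))) (by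
    intro a
    have h := congrFun h1 (r a)
    simp only [mulVec, dotProduct, Pi.one_apply, mul_one, Pi.zero_apply] at h
    rw [← h, ← e.sum_comp, Fintype.sum_prod_type, Finset.sum_comm]
    refine Finset.sum_congr rfl fun b _ => ?_
    rw [of_apply, Finset.sum_range]
    simp [he])

end Circulant

end Matrix

/-! ### Extents of Laurent polynomials -/

namespace LaurentPolynomial

section Extent

variable {F : Type*} [CommRing F]

/-- The lowest exponent of `f` is `a` and the highest one is `b`. -/
structure HasExtent (f : F[T;T⁻¹]) (a b : ℤ) : Prop where
  coeff_low : f.coeff a ≠ 0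
  coeff_high : f.coeff b ≠ 0
  mem_Icc : ∀ n, f.coeff n ≠ 0 → a ≤ n ∧ n ≤ b

theorem exists_hasExtent {f : F[T;T⁻¹]} (hf : f ≠ 0) : ∃ a b, f.HasExtent a b := by
  have h : f.coeff.support.Nonempty := by
    rw [Finsupp.support_nonempty_iff]
    intro h
    exact hf (LaurentPolynomial.ext fun a => by rw [h]; rfl)
  refine ⟨f.coeff.support.min' h, f.coeff.support.max' h, ?_, ?_, fun n hn => ⟨?_, ?_⟩⟩
  · exact Finsupp.mem_support_iff.1 (Finset.min'_mem _ h)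
  · exact Finsupp.mem_support_iff.1 (Finset.max'_mem _ h)
  · exact Finset.min'_le _ _ (Finsupp.mem_support_iff.2 hn)
  · exact Finset.le_max' _ _ (Finsupp.mem_support_iff.2 hn)

theorem HasExtent.le {f : F[T;T⁻¹]} {a b : ℤ} (hf : f.HasExtent a b) : a ≤ b :=
  (hf.mem_Icc a hf.coeff_low).2

theorem HasExtent.eq {f : F[T;T⁻¹]} {a b c d : ℤ} (hf : f.HasExtent a b) (hf' : f.HasExtent c d) :
    a = c ∧ b = d :=
  ⟨le_antisymm (hf.mem_Icc _ hf'.coeff_low).1 (hf'.mem_Icc _ hf.coeff_low).1,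
    le_antisymm (hf'.mem_Icc _ hf.coeff_high).2 (hf.mem_Icc _ hf'.coeff_high).2⟩

theorem HasExtent.laurentSpan_eq {f : ℤ[T;T⁻¹]} {a b : ℤ} (hf : f.HasExtent a b) :
    laurentSpan f = b - a := by
  have h : f.coeff.support.Nonempty := ⟨a, Finsupp.mem_support_iff.2 hf.coeff_low⟩
  have h' : f.HasExtent (f.coeff.support.min' h) (f.coeff.support.max' h) :=
    ⟨Finsupp.mem_support_iff.1 (Finset.min'_mem _ h),
      Finsupp.mem_support_iff.1 (Finset.max'_mem _ h), fun n hn =>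
      ⟨Finset.min'_le _ _ (Finsupp.mem_support_iff.2 hn),
        Finset.le_max' _ _ (Finsupp.mem_support_iff.2 hn)⟩⟩
  rw [laurentSpan, dif_pos h, (hf.eq h').1, (hf.eq h').2]

theorem HasExtent.one [Nontrivial F] : (1 : F[T;T⁻¹]).HasExtent 0 0 := by
  have h : ∀ n, (1 : F[T;T⁻¹]).coeff n = if n = 0 then 1 else 0 := by
    intro n
    rw [AddMonoidAlgebra.one_def, AddMonoidAlgebra.coeff_single, Finsupp.single_apply]
    simp only [eq_comm]
  refine ⟨by simp [h], by simp [h], fun n hn => ?_⟩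
  rw [h] at hn
  have : n = 0 := by
    by_contra h0
    exact hn (if_neg h0)
  omega

/-- The extreme exponents of a product arise in only one way, and their coefficients do not cancel
in a domain. -/
theorem HasExtent.mul [IsDomain F] {f g : F[T;T⁻¹]} {a b c d : ℤ} (hf : f.HasExtent a b)
    (hg : g.HasExtent c d) : (f * g).HasExtent (a + c) (b + d) := by
  classical
  have hfs : ∀ x ∈ f.coeff.support, a ≤ x ∧ x ≤ b := fun x hx =>
    hf.mem_Icc x (Finsupp.mem_support_iff.1 hx)
  have hgs : ∀ x ∈ g.coeff.support, c ≤ x ∧ x ≤ d := fun x hx =>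
    hg.mem_Icc x (Finsupp.mem_support_iff.1 hx)
  refine ⟨?_, ?_, fun n hn => ?_⟩
  · rw [AddMonoidAlgebra.coeff_mul_add_of_uniqueAdd]
    · exact mul_ne_zero hf.coeff_low hg.coeff_low
    · intro x y hx hy h
      have := hfs x hx
      have := hgs y hy
      omega
  · rw [AddMonoidAlgebra.coeff_mul_add_of_uniqueAdd]
    · exact mul_ne_zero hf.coeff_high hg.coeff_high
    · intro x y hx hy h
      have := hfs x hx
      have := hgs y hy
      omega
  · have := AddMonoidAlgebra.support_coeff_mul_subset f g (Finsupp.mem_support_iff.2 hn)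
    obtain ⟨x, hx, y, hy, rfl⟩ := Finset.mem_add.1 this
    have := hfs x hx
    have := hgs y hy
    omega

theorem HasExtent.pow [IsDomain F] {f : F[T;T⁻¹]} {a b : ℤ} (hf : f.HasExtent a b) (n : ℕ) :
    (f ^ n).HasExtent (n * a) (n * b) := by
  induction n with
  | zero => simpa using HasExtent.one
  | succ n ih =>
    have := ih.mul hf
    rw [pow_succ]
    convert this using 1 <;> push_cast <;> ring

end Extent

/-- Reduction of the coefficients modulo `p`. -/
noncomputable def reduceMod (p : ℕ) : ℤ[T;T⁻¹] →+* (ZMod p)[T;T⁻¹] :=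
  AddMonoidAlgebra.mapRingHom ℤ (Int.castRingHom (ZMod p))

theorem coeff_reduceMod (p : ℕ) (f : ℤ[T;T⁻¹]) (n : ℤ) :
    (reduceMod p f).coeff n = (f.coeff n : ZMod p) := by
  simp [reduceMod]

theorem HasExtent.isUnit {f : ℤ[T;T⁻¹]} {a : ℤ} (hf : f.HasExtent a a)
    (h1 : IsUnit (GaussCode.evalOne f)) : IsUnit f := by
  have hfa : f = C (f.coeff a) * T a := by
    rw [← single_eq_C_mul_T]
    refine LaurentPolynomial.ext fun n => ?_
    rw [AddMonoidAlgebra.coeff_single, Finsupp.single_apply]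
    split_ifs with h
    · rw [h]
    · by_contra hn
      have := hf.mem_Icc n hn
      omega
  rw [hfa]
  refine IsUnit.mul ?_ (isUnit_T a)
  rw [hfa, map_mul, GaussCode.evalOne_T, mul_one, GaussCode.evalOne, eval₂_C] at h1
  exact h1.map C

/-- Extents add under multiplication. If `d` has positive span, the factor `d ^ (p - 1)` contributes
at least `p - 1`. If it has span zero, so have `d ^ p` and its divisor; then `Δ` is a monomial whose
coefficient is its value at one, a unit. -/
theorem dvd_coeff_or_le_laurentSpan {Δ : ℤ[T;T⁻¹]} (h1 : IsUnit (GaussCode.evalOne Δ))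
    (hΔ : ¬ IsUnit Δ) {p : ℕ} [hp : Fact p.Prime] {d : (ZMod p)[T;T⁻¹]}
    (hd : d ^ (p - 1) ∣ reduceMod p Δ) (hd' : reduceMod p Δ ∣ d ^ p) :
    (∃ n : ℤ, Δ.coeff n ≠ 0 ∧ (p : ℤ) ∣ Δ.coeff n) ∨ (p : ℤ) - 1 ≤ laurentSpan Δ := by
  rw [or_iff_not_imp_left]
  intro hn
  -- When `p` divides no nonzero coefficient, reduction modulo `p` preserves the set of exponents.
  have hcoeff : ∀ n, (reduceMod p Δ).coeff n ≠ 0 ↔ Δ.coeff n ≠ 0 := by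
    intro n
    rw [coeff_reduceMod, Ne, ZMod.intCast_zmod_eq_zero_iff_dvd]
    refine ⟨fun h h0 => h (by rw [h0]; exact dvd_zero _), fun h hdvd => hn ⟨n, h, hdvd⟩⟩
  have hΔ0 : Δ ≠ 0 := by
    rintro rfl
    simp at h1
  obtain ⟨a, b, hab⟩ := exists_hasExtent hΔ0
  have hab' : (reduceMod p Δ).HasExtent a b :=
    ⟨(hcoeff a).2 hab.coeff_low, (hcoeff b).2 hab.coeff_high,
      fun n hn => hab.mem_Icc n ((hcoeff n).1 hn)⟩
  have hm0 : reduceMod p Δ ≠ 0 := by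
    intro h
    apply hab'.coeff_low
    rw [h]
    rfl
  have hp2 := hp.out.two_le
  have hd0 : d ≠ 0 := by
    rintro rfl
    rw [zero_pow (by omega)] at hd
    exact hm0 (zero_dvd_iff.1 hd)
  obtain ⟨c, e, hce⟩ := exists_hasExtent hd0
  obtain ⟨g, hg⟩ := hd
  obtain ⟨g', hg'⟩ := hd'
  rw [hab.laurentSpan_eq]
  rcases hce.le.lt_or_eq with hlt | rfl
  · have hg0 : g ≠ 0 := by
      rintro rfl
      exact hm0 (by rw [hg, mul_zero])
    obtain ⟨u, v, huv⟩ := exists_hasExtent hg0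
    have h2 := (hce.pow (p - 1)).mul huv
    rw [← hg] at h2
    obtain ⟨rfl, rfl⟩ := hab'.eq h2
    have huv' := huv.le
    have hp1 : ((p - 1 : ℕ) : ℤ) = p - 1 := by push_cast [Nat.cast_sub (show 1 ≤ p by omega)]; rfl
    rw [hp1]
    nlinarith
  · exfalso
    have hg0 : g' ≠ 0 := by
      rintro rfl
      rw [mul_zero] at hg'
      exact hd0 (pow_eq_zero_iff (by omega) |>.1 hg')
    obtain ⟨u, v, huv⟩ := exists_hasExtent hg0
    have h2 := hab'.mul huv
    rw [← hg'] at h2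
    have h3 := h2.eq (hce.pow p)
    have huv' := huv.le
    have hab2 := hab.le
    have : a = b := by omega
    subst this
    exact hΔ (hab.isUnit h1)

end LaurentPolynomial

/-! ### Tangent directions of invariant curves -/

open Filter Topology in
-- The reparametrisation of an invariant curve is only known to be an increasing homeomorphism, so
-- the chain rule is not available. Normalised secants do not depend on the parametrisation, and
-- approaching from the right fixes their orientation.
theorem tendsto_direction {f : ℝ → ℂ} {v : ℂ} {x : ℝ} (hf : HasDerivAt f v x) (hv : v ≠ 0) :
    Tendsto (fun y => ‖f y - f x‖⁻¹ • (f y - f x)) (𝓝[>] x) (𝓝 (‖v‖⁻¹ • v)) := by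
  have h1 : Tendsto (slope f x) (𝓝[>] x) (𝓝 v) :=
    (hasDerivAt_iff_tendsto_slope.1 hf).mono_left (nhdsWithin_mono x fun y hy => ne_of_gt hy)
  have h2 : Tendsto (fun y => ‖slope f x y‖⁻¹ • slope f x y) (𝓝[>] x) (𝓝 (‖v‖⁻¹ • v)) :=
    (h1.norm.inv₀ (norm_ne_zero_iff.2 hv)).smul h1
  refine h2.congr' ?_
  filter_upwards [self_mem_nhdsWithin] with y hy
  have hy' : 0 < y - x := sub_pos.2 hy
  rw [slope_def_module, norm_smul, smul_smul, mul_inv, norm_inv, Real.norm_of_nonneg hy'.le, inv_inv]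
  congr 1
  field_simp

/-- If a homothety maps a curve into itself, monotonically for the parameters, it maps tangent
directions to tangent directions. -/
theorem exists_deriv_eq_smul {γ : ℝ → ℂ} (hγ : Differentiable ℝ γ) (himm : ∀ s, deriv γ s ≠ 0)
    {ζ : ℂ} (hζ : ζ ≠ 0) (φ : ℝ ≃o ℝ) (h : ∀ s, ζ * γ s = γ (φ s)) (s : ℝ) :
    ∃ c : ℝ, 0 < c ∧ deriv γ (φ s) = c • (ζ * deriv γ s) := by
  have h1 := tendsto_direction (hγ (φ s)).hasDerivAt (himm (φ s))
  have h2 := tendsto_direction ((hγ s).hasDerivAt.const_mul ζ) (mul_ne_zero hζ (himm s))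
  -- Monotonicity sends right neighbourhoods to right neighbourhoods, so the factor `c` is positive
  -- and not merely nonzero.
  have hφ : Filter.Tendsto φ (nhdsWithin s (Set.Ioi s)) (nhdsWithin (φ s) (Set.Ioi (φ s))) := by
    apply tendsto_nhdsWithin_of_tendsto_nhds_of_eventually_within
    · exact φ.continuous.continuousAt.tendsto.mono_left nhdsWithin_le_nhds
    · filter_upwards [self_mem_nhdsWithin] with y hy
      exact φ.strictMono hy
  have h3 := h1.comp hφ
  simp only [Function.comp_def, ← h] at h3
  have h4 := tendsto_nhds_unique h3 h2
  have hw := norm_pos_iff.2 (himm (φ s))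
  have hv := norm_pos_iff.2 (mul_ne_zero hζ (himm s))
  refine ⟨‖deriv γ (φ s)‖ * ‖ζ * deriv γ s‖⁻¹, by positivity, ?_⟩
  rw [mul_smul, ← h4, smul_smul, mul_inv_cancel₀ hw.ne', one_smul]

theorem planeCross_smul_mul (a b : ℝ) (ζ v w : ℂ) :
    planeCross (a • (ζ * v)) (b • (ζ * w)) = a * b * Complex.normSq ζ * planeCross v w := by
  simp only [planeCross, Complex.real_smul, Complex.mul_re, Complex.mul_im, Complex.ofReal_re,
    Complex.ofReal_im, Complex.normSq_apply]
  ring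

/-! ### Gauss codes of diagrams with a rotational symmetry -/

/-- A symmetry of a Gauss code: shifting the positions by `m` maps over-passages to over-passages
and crossings to crossings of the same sign. -/
structure GaussCode.IsShiftSymmetric (D : GaussCode) (letterAt : ℤ → GaussLetter) (m : ℤ) :
    Prop where
  letterAt_idxOf : ∀ a ∈ D.word, ∀ z : ℤ, z = D.word.idxOf a → letterAt z = a
  mem : ∀ z, letterAt z ∈ D.word
  eq_iff : ∀ y z, letterAt y = letterAt z ↔ (D.word.length : ℤ) ∣ y - z
  isOver : ∀ z, (letterAt (z + m)).isOver = (letterAt z).isOver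
  sign : ∀ z, (letterAt (z + m)).sign = (letterAt z).sign
  partner : ∀ y z, letterAt y = (letterAt z).partner → letterAt (y + m) = (letterAt (z + m)).partner

/-! ### The permutation of the crossings induced by a shift -/

namespace GaussCode.IsShiftSymmetric

variable {D : GaussCode} {W : ℤ → GaussLetter} {m : ℤ}

/-- The effect of the shift on the letters. -/
def shift (D : GaussCode) (W : ℤ → GaussLetter) (m : ℤ) (a : GaussLetter) : GaussLetter :=
  if a ∈ D.word then W (D.word.idxOf a + m) else a

theorem exists_eq (h : D.IsShiftSymmetric W m) {a : GaussLetter} (ha : a ∈ D.word) :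
    ∃ z, W z = a := ⟨_, h.letterAt_idxOf a ha _ rfl⟩

theorem shift_letterAt (h : D.IsShiftSymmetric W m) (z : ℤ) : shift D W m (W z) = W (z + m) := by
  rw [shift, if_pos (h.mem z), h.eq_iff]
  have := (h.eq_iff _ _).1 (h.letterAt_idxOf _ (h.mem z) _ rfl)
  simpa using this

theorem shift_mem (h : D.IsShiftSymmetric W m) {a : GaussLetter} (ha : a ∈ D.word) :
    shift D W m a ∈ D.word := by
  obtain ⟨z, rfl⟩ := h.exists_eq ha
  rw [h.shift_letterAt]
  exact h.mem _

theorem shift_isOver (h : D.IsShiftSymmetric W m) (a : GaussLetter) :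
    (shift D W m a).isOver = a.isOver := by
  by_cases ha : a ∈ D.word
  · obtain ⟨z, rfl⟩ := h.exists_eq ha
    rw [h.shift_letterAt, h.isOver]
  · rw [shift, if_neg ha]

theorem shift_injOn (h : D.IsShiftSymmetric W m) {a b : GaussLetter} (ha : a ∈ D.word)
    (hb : b ∈ D.word) (hab : shift D W m a = shift D W m b) : a = b := by
  obtain ⟨y, rfl⟩ := h.exists_eq ha
  obtain ⟨z, rfl⟩ := h.exists_eq hb
  rw [h.shift_letterAt, h.shift_letterAt, h.eq_iff] at hab
  rw [h.eq_iff]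
  simpa using hab

theorem shift_partner (h : D.IsShiftSymmetric W m) {a : GaussLetter} (ha : a ∈ D.word) :
    shift D W m a.partner = (shift D W m a).partner := by
  obtain ⟨z, rfl⟩ := h.exists_eq ha
  obtain ⟨y, hy⟩ := h.exists_eq (D.partner_mem _ ha)
  rw [← hy, h.shift_letterAt, h.shift_letterAt]
  exact h.partner y z hy

theorem getElem_eq (h : D.IsShiftSymmetric W m) {k : ℕ} (hk : k < D.word.length) :
    D.word[k] = W k :=
  (h.letterAt_idxOf _ (List.getElem_mem hk) k (by rw [D.nodup.idxOf_getElem])).symm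

theorem getElem_mod_eq (h : D.IsShiftSymmetric W m) {k : ℕ}
    (hk : k % D.word.length < D.word.length) : D.word[k % D.word.length] = W k := by
  rw [h.getElem_eq hk, h.eq_iff]
  push_cast
  rw [← Int.emod_add_mul_ediv (k : ℤ) D.word.length]
  simp

theorem nextUnder_shift (h : D.IsShiftSymmetric W m) {a : GaussLetter} (ha : a ∈ D.word) :
    D.nextUnder (shift D W m a) = (D.nextUnder a).map (shift D W m) := by
  have hrot : D.word.rotate (D.word.idxOf (shift D W m a) + 1)
      = (D.word.rotate (D.word.idxOf a + 1)).map (shift D W m) := by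
    apply List.ext_getElem
    · simp
    · intro i h1 h2
      have ha1 := h.letterAt_idxOf a ha _ rfl
      have ha2 := h.letterAt_idxOf _ (h.shift_mem ha) _ rfl
      have hd : (D.word.length : ℤ) ∣ (D.word.idxOf (shift D W m a) : ℤ) - (D.word.idxOf a + m) := by
        rw [← h.eq_iff, ha2, ← h.shift_letterAt, ha1]
      rw [List.getElem_map, List.getElem_rotate, List.getElem_rotate, h.getElem_mod_eq,
        h.getElem_mod_eq, h.shift_letterAt, h.eq_iff]
      push_cast
      convert hd using 1
      ring
  rw [nextUnder, nextUnder, hrot, List.find?_map]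
  congr 2
  ext b
  simp [h.shift_isOver]

/-- The permutation of the under-passages given by the shift. -/
noncomputable def perm (h : D.IsShiftSymmetric W m) : Equiv.Perm D.Under :=
  Equiv.ofBijective
    (fun a => ⟨shift D W m a.1, Finset.mem_filter.2
      ⟨List.mem_toFinset.2 (h.shift_mem (D.under_mem a)), by
        rw [h.shift_isOver, D.under_isOver]⟩⟩)
    (Finite.injective_iff_bijective.1 fun a b hab =>
      Subtype.ext (h.shift_injOn (D.under_mem a) (D.under_mem b) (Subtype.mk.inj hab)))

theorem coe_perm (h : D.IsShiftSymmetric W m) (a : D.Under) : (h.perm a).1 = shift D W m a.1 := rfl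

theorem coe_perm_pow (h : D.IsShiftSymmetric W m) (a : D.Under) {z : ℤ} (hz : W z = a.1) (k : ℕ) :
    ((h.perm ^ k) a).1 = W (z + k * m) := by
  induction k with
  | zero => simp [hz]
  | succ k ih =>
    rw [pow_succ', Equiv.Perm.mul_apply, coe_perm, ih, h.shift_letterAt]
    congr 1
    push_cast
    ring

theorem perm_pow_eq_one (h : D.IsShiftSymmetric W m) {k : ℕ}
    (hk : (D.word.length : ℤ) ∣ k * m) : h.perm ^ k = 1 := by
  ext1 a
  obtain ⟨z, hz⟩ := h.exists_eq (D.under_mem a)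
  apply Subtype.ext
  rw [h.coe_perm_pow a hz, Equiv.Perm.one_apply, ← hz, h.eq_iff]
  simpa using hk

theorem perm_apply_ne (h : D.IsShiftSymmetric W m) (hm : ¬ (D.word.length : ℤ) ∣ m) (a : D.Under) :
    h.perm a ≠ a := by
  obtain ⟨z, hz⟩ := h.exists_eq (D.under_mem a)
  intro ha
  have h1 := congrArg Subtype.val ha
  rw [coe_perm, ← hz, h.shift_letterAt, h.eq_iff] at h1
  exact hm (by simpa using h1)

theorem jacobian_perm (h : D.IsShiftSymmetric W m) (a b : D.Under) :
    D.jacobian (h.perm a) (h.perm b) = D.jacobian a b := by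
  have h1 : (h.perm a).1.sign = a.1.sign := by
    obtain ⟨z, hz⟩ := h.exists_eq (D.under_mem a)
    rw [coe_perm, ← hz, h.shift_letterAt, h.sign]
  have h2 : ∀ c ∈ D.word,
      (D.nextUnder (shift D W m c) = some (h.perm b).1) = (D.nextUnder c = some b.1) := by
    intro c hc
    rw [h.nextUnder_shift hc, coe_perm, eq_iff_iff]
    constructor
    · intro hmap
      obtain ⟨e, he, hse⟩ := Option.map_eq_some_iff.1 hmap
      rw [he, h.shift_injOn (GaussWord.firstUnder_eq_some he).1 (D.under_mem b) hse]
    · intro he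
      rw [he]
      rfl
  have h3 : (h.perm b = h.perm a) = (b = a) := by rw [h.perm.injective.eq_iff]
  rw [jacobian, h1, coe_perm h a, ← h.shift_partner (D.under_mem a), jacobian]
  simp only [h2 _ (D.under_mem a), h2 _ (D.partner_mem _ (D.under_mem a)), h3]

end GaussCode.IsShiftSymmetric

/-! ### The cyclic enumeration of the classical crossings of a diagram -/

theorem SameParam.symm {s t : ℝ} (h : SameParam s t) : SameParam t s := by
  obtain ⟨n, rfl⟩ := h
  exact ⟨-n, by push_cast; ring⟩

namespace VirtualDiagram

variable (P : VirtualDiagram)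

theorem curve_eq_of_sameParam {s t : ℝ} (h : SameParam s t) : P.curve s = P.curve t := by
  obtain ⟨n, rfl⟩ := h
  have := (show Function.Periodic P.curve 1 from P.periodic).int_mul n s
  simpa using this.symm

theorem deriv_eq_of_sameParam {s t : ℝ} (h : SameParam s t) :
    deriv P.curve s = deriv P.curve t := by
  obtain ⟨n, rfl⟩ := h
  rw [← deriv_comp_add_const]
  congr 1
  ext x
  exact P.curve_eq_of_sameParam ⟨n, rfl⟩

theorem crossesOver_iff_of_sameParam {s t s' t' : ℝ} (hs : SameParam s s') (ht : SameParam t t') :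
    P.crossesOver s t ↔ P.crossesOver s' t' :=
  ⟨P.over_periodic s t s' t' hs ht, P.over_periodic s' t' s t hs.symm ht.symm⟩

/-- A parameter at which the diagram passes through a classical crossing. -/
def IsPassage (x : ℝ) : Prop := ∃ y, P.crossesOver x y ∨ P.crossesOver y x

theorem isPassage_of_sameParam {x x' : ℝ} (h : SameParam x x') (hx : P.IsPassage x) :
    P.IsPassage x' := by
  obtain ⟨y, hy⟩ := hx
  exact ⟨y, hy.imp (P.crossesOver_iff_of_sameParam h ⟨0, by simp⟩).1
    (P.crossesOver_iff_of_sameParam ⟨0, by simp⟩ h).1⟩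

/-- An enumeration of the passages of a diagram in increasing order, with the letters that they
have in a Gauss code. -/
structure IsEnumeration (D : GaussCode) (S : ℤ → ℝ) (W : ℤ → GaussLetter) : Prop where
  strictMono : StrictMono S
  exists_eq : ∀ x, P.IsPassage x → ∃ z, S z = x
  isPassage : ∀ z, P.IsPassage (S z)
  sameParam_iff : ∀ y z, SameParam (S z) (S y) ↔ (D.word.length : ℤ) ∣ y - z
  letterAt_idxOf : ∀ a ∈ D.word, ∀ z : ℤ, z = D.word.idxOf a → W z = a
  mem : ∀ z, W z ∈ D.word
  eq_iff : ∀ y z, W y = W z ↔ (D.word.length : ℤ) ∣ y - z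
  crossesOver_iff : ∀ y z, P.crossesOver (S y) (S z) ↔
    (W y).isOver = true ∧ (W z).isOver = false ∧ (W y).label = (W z).label
  sign : ∀ y z, P.crossesOver (S y) (S z) →
    0 < (((W y).sign : ℤ) : ℝ) * planeCross (deriv P.curve (S y)) (deriv P.curve (S z))

variable {P}

theorem HasGaussCode.exists_isEnumeration {D : GaussCode} (h : P.HasGaussCode D)
    [Nonempty D.Under] : ∃ S W, P.IsEnumeration D S W := by
  obtain ⟨s, hmono, hIco, hex, hcross, hsign⟩ := h
  have hNpos : 0 < D.word.length := by
    obtain ⟨a⟩ := ‹Nonempty D.Under›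
    exact List.length_pos_of_mem (D.under_mem a)
  have hNZ : (0 : ℤ) < D.word.length := by exact_mod_cast hNpos
  have hlt : ∀ z : ℤ, (z % D.word.length).toNat < D.word.length := fun z => by
    have := Int.emod_lt_of_pos z hNZ
    have := Int.emod_nonneg z hNZ.ne'
    omega
  let idx : ℤ → Fin D.word.length := fun z => ⟨(z % D.word.length).toNat, hlt z⟩
  have hidx : ∀ z, ((idx z : ℕ) : ℤ) = z % D.word.length := fun z =>
    Int.toNat_of_nonneg (Int.emod_nonneg z hNZ.ne')
  have hidx_iff : ∀ y z, idx y = idx z ↔ (D.word.length : ℤ) ∣ y - z := by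
    intro y z
    rw [Fin.ext_iff, ← Nat.cast_inj (R := ℤ), hidx, hidx,
      Int.emod_eq_emod_iff_emod_sub_eq_zero, Int.dvd_iff_emod_eq_zero]
  -- One turn around the circle contains `D.word.length` passages: the quotient counts the turns and
  -- the remainder selects the passage.
  let S : ℤ → ℝ := fun z => ((z / D.word.length : ℤ) : ℝ) + s (idx z)
  have hSs : ∀ z, SameParam (s (idx z)) (S z) := fun z => ⟨z / D.word.length, add_comm _ _⟩
  have hS : StrictMono S := by
    intro y z hyz
    have h1 := Int.emod_add_mul_ediv y D.word.length
    have h2 := Int.emod_add_mul_ediv z D.word.length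
    rcases (Int.ediv_le_ediv hNZ hyz.le).lt_or_eq with hlt | heq
    · have h3 : ((y / D.word.length : ℤ) : ℝ) + 1 ≤ ((z / D.word.length : ℤ) : ℝ) := by exact_mod_cast hlt
      have h4 := (hIco (idx y)).2
      have h5 := (hIco (idx z)).1
      simp only [S]
      linarith
    · have h3 : idx y < idx z := by
        rw [Fin.lt_def, ← Int.ofNat_lt, hidx, hidx]
        rw [heq] at h1
        linarith
      simp only [S, heq]
      linarith [hmono h3]
  have hsame : ∀ y z, SameParam (S z) (S y) ↔ (D.word.length : ℤ) ∣ y - z := by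
    have hshift : ∀ (z n : ℤ), S (z + D.word.length * n) = S z + n := by
      intro z n
      have : idx (z + D.word.length * n) = idx z := by
        rw [hidx_iff]
        simp
      simp only [S, this]
      rw [Int.add_mul_ediv_left _ _ hNZ.ne']
      push_cast
      ring
    intro y z
    constructor
    · rintro ⟨n, hn⟩
      rw [← hshift] at hn
      exact ⟨n, by rw [hS.injective hn]; ring⟩
    · rintro ⟨n, hn⟩
      exact ⟨n, by rw [← hshift, ← hn]; congr 1; ring⟩
  have hcr : ∀ y z, P.crossesOver (S y) (S z) ↔ P.crossesOver (s (idx y)) (s (idx z)) :=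
    fun y z => P.crossesOver_iff_of_sameParam (hSs y).symm (hSs z).symm
  refine ⟨S, fun z => D.word.get (idx z), hS, ?_, ?_, hsame, ?_, fun z => List.get_mem _ _, ?_, ?_,
    ?_⟩
  · intro x hx
    have hx' : P.IsPassage (Int.fract x) :=
      P.isPassage_of_sameParam ⟨-⌊x⌋, by rw [Int.fract]; push_cast; ring⟩ hx
    obtain ⟨i, hi⟩ := hex (Int.fract x) ⟨Int.fract_nonneg x, Int.fract_lt_one x⟩ hx'
    have hi1 : (0 : ℤ) ≤ (i : ℕ) := by positivity
    have hi2 : ((i : ℕ) : ℤ) < D.word.length := by exact_mod_cast i.2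
    have h1 : ((i : ℕ) + D.word.length * ⌊x⌋ : ℤ) / D.word.length = ⌊x⌋ := by
      rw [Int.add_mul_ediv_left _ _ hNZ.ne', Int.ediv_eq_zero_of_lt hi1 hi2, zero_add]
    have h2 : idx ((i : ℕ) + D.word.length * ⌊x⌋ : ℤ) = i := by
      rw [Fin.ext_iff, ← Nat.cast_inj (R := ℤ), hidx, Int.add_mul_emod_self_left,
        Int.emod_eq_of_lt hi1 hi2]
    refine ⟨(i : ℕ) + D.word.length * ⌊x⌋, ?_⟩
    simp only [S, h1, h2, hi]
    exact Int.floor_add_fract x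
  · intro z
    refine P.isPassage_of_sameParam (hSs z) ?_
    obtain ⟨j, hj⟩ := List.get_of_mem (D.partner_mem _ (List.get_mem D.word (idx z)))
    by_cases ho : (D.word.get (idx z)).isOver = true
    · refine ⟨s j, Or.inl ((hcross _ _).2 ⟨ho, ?_, ?_⟩)⟩ <;> rw [hj] <;>
        simp only [GaussLetter.partner, ho, Bool.not_true]
    · have ho' : (D.word.get (idx z)).isOver = false := by simpa using ho
      refine ⟨s j, Or.inr ((hcross _ _).2 ⟨?_, ho', ?_⟩)⟩ <;> rw [hj] <;>
        simp only [GaussLetter.partner, ho', Bool.not_false]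
  · rintro a ha z rfl
    have h1 := List.idxOf_lt_length_iff.2 ha
    have : idx (D.word.idxOf a : ℤ) = ⟨D.word.idxOf a, h1⟩ := by
      rw [Fin.ext_iff, ← Nat.cast_inj (R := ℤ), hidx]
      exact Int.emod_eq_of_lt (by positivity) (by exact_mod_cast h1)
    rw [this]
    simp
  · intro y z
    rw [← hidx_iff]
    exact D.nodup.injective_get.eq_iff
  · intro y z
    rw [hcr, hcross]
  · intro y z hyz
    rw [← P.deriv_eq_of_sameParam (hSs y), ← P.deriv_eq_of_sameParam (hSs z)]
    exact hsign _ _ ((hcr y z).1 hyz)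

theorem exp_ne_one {p : ℕ} (hp : 2 ≤ p) : Complex.exp (2 * Real.pi * Complex.I / p) ≠ 1 := by
  have h := Complex.isPrimitiveRoot_exp p (by omega)
  exact h.ne_one (by omega)

/-- A rotationally invariant diagram has a Gauss code with a free cyclic symmetry. -/
theorem IsRotationInvariant.exists_isShiftSymmetric {D : GaussCode} {p : ℕ} (hp : 2 ≤ p)
    (hD : P.HasGaussCode D) (h0 : P.MissesOrigin) (hP : P.IsRotationInvariant p)
    [Nonempty D.Under] :
    ∃ W m, D.IsShiftSymmetric W m ∧ (D.word.length : ℤ) ∣ p * m ∧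
      ¬ (D.word.length : ℤ) ∣ m := by
  obtain ⟨S, W, hE⟩ := hD.exists_isEnumeration
  obtain ⟨φ, hφ1, hφ2, hφ3⟩ := hP
  set ζ := Complex.exp (2 * Real.pi * Complex.I / p) with hζ
  have hζ0 : ζ ≠ 0 := Complex.exp_ne_zero _
  have hpass : ∀ x, P.IsPassage x → P.IsPassage (φ x) := by
    rintro x ⟨y, hy⟩
    exact ⟨φ y, hy.imp (hφ3 _ _).1 (hφ3 _ _).1⟩
  have hpass' : ∀ x, P.IsPassage x → P.IsPassage (φ.symm x) := by
    rintro x ⟨y, hy⟩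
    refine ⟨φ.symm y, hy.imp ?_ ?_⟩ <;>
    · intro h
      rw [hφ3]
      simpa using h
  -- The rotation permutes the passages in increasing order. An increasing bijection of `ℤ` commutes
  -- with the successor and is therefore a translation, here by `m`.
  have hψ : ∀ z, ∃ y, S y = φ (S z) := fun z => hE.exists_eq _ (hpass _ (hE.isPassage z))
  choose ψ hψ using hψ
  have hψm : StrictMono ψ := by
    intro y z hyz
    rw [← hE.strictMono.lt_iff_lt, hψ, hψ]
    exact φ.strictMono (hE.strictMono hyz)
  have hψs : Function.Surjective ψ := by
    intro y
    obtain ⟨z, hz⟩ := hE.exists_eq _ (hpass' _ (hE.isPassage y))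
    refine ⟨z, hE.strictMono.injective ?_⟩
    rw [hψ, hz]
    simp
  have hsucc : ∀ z, ψ (z + 1) = ψ z + 1 := fun z =>
    (hψm.orderIsoOfSurjective ψ hψs).map_succ z
  have hm : ∀ z, ψ z = z + ψ 0 := by
    intro z
    induction z with
    | zero => simp
    | succ z ih => rw [hsucc, ih]; ring
    | pred z ih =>
      have := hsucc (-(z : ℤ) - 1)
      rw [sub_add_cancel, ih] at this
      linarith
  set m := ψ 0 with hmdef
  have hS : ∀ z, S (z + m) = φ (S z) := fun z => by rw [← hm, hψ]
  have hcr : ∀ y z, P.crossesOver (S (y + m)) (S (z + m)) ↔ P.crossesOver (S y) (S z) :=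
    fun y z => by rw [hS, hS, ← hφ3]
  have hWex : ∀ a ∈ D.word, ∃ z, W z = a := fun a ha => ⟨_, hE.letterAt_idxOf a ha _ rfl⟩
  have hpartner : ∀ z, ∃ y, W y = (W z).partner := fun z => hWex _ (D.partner_mem _ (hE.mem z))
  have hcross : ∀ y z, W y = (W z).partner → (W z).isOver = false → P.crossesOver (S y) (S z) := by
    intro y z h ho
    rw [hE.crossesOver_iff, h]
    simp [GaussLetter.partner, ho]
  have hpp : ∀ a : GaussLetter, a.partner.partner = a := fun a => by
    simp [GaussLetter.partner]
  have hcross' : ∀ y z, P.crossesOver (S y) (S z) → W y = (W z).partner := by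
    intro y z h
    obtain ⟨h1, h2, h3⟩ := (hE.crossesOver_iff _ _).1 h
    exact D.eq_of_label_eq (hE.mem y) (D.partner_mem _ (hE.mem z)) h3
      (by simp [GaussLetter.partner, h1, h2])
  have hover : ∀ z, (W (z + m)).isOver = (W z).isOver := by
    intro z
    obtain ⟨y, hy⟩ := hpartner z
    cases ho : (W z).isOver with
    | false => exact ((hE.crossesOver_iff _ _).1 ((hcr _ _).2 (hcross y z hy ho))).2.1
    | true =>
      have h1 := hcross z y (by rw [hy, hpp]) (by simp [hy, GaussLetter.partner, ho])
      exact ((hE.crossesOver_iff _ _).1 ((hcr _ _).2 h1)).1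
  -- Tangent vectors are rotated and rescaled by positive factors, so cross products at crossings
  -- keep their signs, and with them the signs of the crossings.
  have hdir : ∀ z, ∃ c : ℝ, 0 < c ∧ deriv P.curve (S (z + m)) = c • (ζ * deriv P.curve (S z)) := by
    intro z
    rw [hS]
    exact exists_deriv_eq_smul (P.smooth.differentiable (by simp)) P.immersion hζ0 φ hφ2 (S z)
  have hsign1 : ∀ y z, P.crossesOver (S y) (S z) → (W (y + m)).sign = (W y).sign := by
    intro y z h
    have h1 := hE.sign _ _ h
    have h2 := hE.sign _ _ ((hcr _ _).2 h)
    obtain ⟨a, ha, hay⟩ := hdir y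
    obtain ⟨b, hb, hbz⟩ := hdir z
    rw [hay, hbz, planeCross_smul_mul] at h2
    have hn := Complex.normSq_pos.2 hζ0
    have hc : 0 < a * b * Complex.normSq ζ := by positivity
    generalize planeCross (deriv P.curve (S y)) (deriv P.curve (S z)) = c at h1 h2
    generalize a * b * Complex.normSq ζ = e at h2 hc
    rcases Int.units_eq_one_or (W (y + m)).sign with hs | hs <;>
      rcases Int.units_eq_one_or (W y).sign with hs' | hs' <;> rw [hs, hs'] <;>
      rw [hs] at h2 <;> rw [hs'] at h1 <;> exfalso <;> norm_num at h1 h2 <;> nlinarith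
  have hpart : ∀ y z, W y = (W z).partner → W (y + m) = (W (z + m)).partner := by
    intro y z h
    cases ho : (W z).isOver with
    | false => exact hcross' _ _ ((hcr _ _).2 (hcross y z h ho))
    | true =>
      have h1 := hcross z y (by rw [h, hpp]) (by simp [h, GaussLetter.partner, ho])
      rw [hcross' _ _ ((hcr _ _).2 h1), hpp]
  have hsign : ∀ z, (W (z + m)).sign = (W z).sign := by
    intro z
    obtain ⟨y, hy⟩ := hpartner z
    cases ho : (W z).isOver with
    | false =>
      have h1 := hsign1 y z (hcross y z hy ho)
      rwa [hpart y z hy, hy] at h1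
    | true =>
      exact hsign1 z y (hcross z y (by rw [hy, hpp]) (by simp [hy, GaussLetter.partner, ho]))
  refine ⟨W, m, ⟨hE.letterAt_idxOf, hE.mem, hE.eq_iff, hover, hsign, hpart⟩, ?_, ?_⟩
  -- After `p` rotations an under-passage returns to its point in the plane. In the absence of
  -- triple points it is again one of the two passages there; it cannot be the over-passage, because
  -- the shift preserves under-passages.
  · obtain ⟨a⟩ := ‹Nonempty D.Under›
    obtain ⟨z, hz⟩ := hWex _ (D.under_mem a)
    obtain ⟨y, hy⟩ := hpartner z
    have hzo : (W z).isOver = false := by rw [hz, D.under_isOver]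
    have hyz := P.over_double _ _ (hcross y z hy hzo)
    have hcurve : ∀ k : ℕ, P.curve (S (z + k * m)) = ζ ^ k * P.curve (S z) := by
      intro k
      induction k with
      | zero => simp
      | succ k ih =>
        have : z + ((k + 1 : ℕ) : ℤ) * m = z + k * m + m := by push_cast; ring
        rw [this, hS, ← hφ2, ih]
        ring
    have hoverk : ∀ k : ℕ, (W (z + k * m)).isOver = false := by
      intro k
      induction k with
      | zero => simpa using hzo
      | succ k ih =>
        have : z + ((k + 1 : ℕ) : ℤ) * m = z + k * m + m := by push_cast; ring
        rw [this, hover, ih]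
    have hζp : ζ ^ p = 1 := (Complex.isPrimitiveRoot_exp p (by omega)).pow_eq_one
    have h1 := hcurve p
    rw [hζp, one_mul] at h1
    rcases P.no_triple (S z) (S y) (S (z + p * m)) hyz.1.symm h1.symm with h | h | h
    · exact absurd h.symm hyz.2
    · rw [hE.sameParam_iff] at h
      simpa using h
    · rw [hE.sameParam_iff, ← hE.eq_iff] at h
      have h2 := hoverk p
      rw [h, hy] at h2
      simp [GaussLetter.partner, hzo] at h2
  -- Otherwise a point of the diagram would be fixed by a nontrivial rotation, although the diagram
  -- misses the origin.
  · intro hdvd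
    have h1 : SameParam (S 0) (S (0 + m)) := (hE.sameParam_iff _ _).2 (by simpa using hdvd)
    have h2 := P.curve_eq_of_sameParam h1
    rw [hS, ← hφ2] at h2
    exact exp_ne_one hp (mul_right_cancel₀ (h0 (S 0)) (by rw [one_mul]; exact h2.symm))

end VirtualDiagram

/-! ### The theorem -/

theorem VirtualKnot.IsAlexanderPolynomial.isUnit_evalOne {K : VirtualKnot} {Δ : ℤ[T;T⁻¹]}
    (hΔ : K.IsAlexanderPolynomial Δ) (hK : K.IsAlmostClassical) :
    IsUnit (GaussCode.evalOne Δ) := by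
  obtain ⟨D, hD, -⟩ := id hΔ
  have h := D.map_evalOne_firstElementaryIdeal
  rw [hΔ.firstElementaryIdeal_eq hK hD, Ideal.map_span, Set.image_singleton] at h
  exact Ideal.span_singleton_eq_top.1 h

/-- Modulo a prime period `p`, the Alexander polynomial lies between the `(p - 1)`-st and the
`p`-th power of another polynomial. -/
theorem VirtualKnot.IsAlexanderPolynomial.exists_reduceMod_dvd_pow {K : VirtualKnot}
    {Δ : ℤ[T;T⁻¹]} (hΔ : K.IsAlexanderPolynomial Δ) (hK : K.IsAlmostClassical)
    (hu : ¬ IsUnit Δ) {p : ℕ} [hp : Fact p.Prime] (hper : K.HasPeriod p) :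
    ∃ d, d ^ (p - 1) ∣ LaurentPolynomial.reduceMod p Δ ∧
      LaurentPolynomial.reduceMod p Δ ∣ d ^ p := by
  obtain ⟨P, D, hcode, hD, h0, hrot⟩ := hper
  -- The periodic diagram need not be numberable itself; that its ideal is generated by `Δ` comes
  -- from another diagram of `K`.
  have hideal := hΔ.firstElementaryIdeal_eq hK hD
  rcases isEmpty_or_nonempty D.Under with hE | hE
  · rw [D.firstElementaryIdeal_of_isEmpty] at hideal
    exact absurd (Ideal.span_singleton_eq_top.1 hideal.symm) hu
  obtain ⟨W, m, hW, hdvd, hndvd⟩ := hrot.exists_isShiftSymmetric hp.out.two_le hcode h0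
  have : CharP (ZMod p)[T;T⁻¹] p :=
    charP_of_injective_ringHom (f := (LaurentPolynomial.C : ZMod p →+* (ZMod p)[T;T⁻¹])) (RingHom.injective _) p
  obtain ⟨d, hd, hd'⟩ := Matrix.exists_adjugateIdeal_le_of_invariant (p := p)
    (A := D.jacobian.map (LaurentPolynomial.reduceMod p)) (τ := hW.perm)
    (fun i j => by rw [Matrix.map_apply, hW.jacobian_perm, Matrix.map_apply])
    (hW.perm_pow_eq_one hdvd) (hW.perm_apply_ne hndvd) (by
      have h := congrArg (fun v => LaurentPolynomial.reduceMod p ∘ v) D.jacobian_mulVec_one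
      ext1 i
      simpa [Matrix.mulVec, dotProduct] using congrFun h i)
  rw [D.firstElementaryIdeal_eq_adjugateIdeal] at hideal
  rw [Matrix.adjugateIdeal_map, hideal, Ideal.map_span, Set.image_singleton] at hd hd'
  exact ⟨d, Ideal.span_singleton_le_span_singleton.1 hd, Ideal.mem_span_singleton.1 hd'⟩

theorem Int.finite_setOf_natCast_dvd {c : ℤ} (hc : c ≠ 0) : {p : ℕ | (p : ℤ) ∣ c}.Finite :=
  (Set.finite_Iic c.natAbs).subset fun _ hp =>
    Nat.le_of_dvd (Int.natAbs_pos.2 hc) (Int.natCast_dvd.1 hp)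

theorem mainTheorem4 (K : VirtualKnot) (hK : K.IsAlmostClassical)
    (Δ : LaurentPolynomial ℤ) (hΔ : K.IsAlexanderPolynomial Δ) (hnontrivial : ¬ IsUnit Δ) :
    (∀ p : ℕ, p.Prime → K.HasPeriod p →
      (∃ n : ℤ, Δ.coeff n ≠ 0 ∧ (p : ℤ) ∣ Δ.coeff n) ∨ (p : ℤ) - 1 ≤ laurentSpan Δ) ∧
    {p : ℕ | p.Prime ∧ K.HasPeriod p}.Finite := by
  have key : ∀ p : ℕ, p.Prime → K.HasPeriod p →
      (∃ n : ℤ, Δ.coeff n ≠ 0 ∧ (p : ℤ) ∣ Δ.coeff n) ∨ (p : ℤ) - 1 ≤ laurentSpan Δ := by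
    intro p hp hper
    have : Fact p.Prime := ⟨hp⟩
    obtain ⟨d, hd, hd'⟩ := hΔ.exists_reduceMod_dvd_pow hK hnontrivial hper
    exact LaurentPolynomial.dvd_coeff_or_le_laurentSpan (hΔ.isUnit_evalOne hK) hnontrivial hd hd'
  -- A period either divides one of the finitely many nonzero coefficients, each with finitely many
  -- divisors, or is at most the span plus one.
  refine ⟨key, Set.Finite.subset (s := (⋃ n ∈ Δ.coeff.support, {p : ℕ | (p : ℤ) ∣ Δ.coeff n}) ∪
    Set.Iic (laurentSpan Δ + 1).toNat) (Set.Finite.union ?_ (Set.finite_Iic _)) ?_⟩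
  · exact Set.Finite.biUnion (Finset.finite_toSet _) fun n hn =>
      Int.finite_setOf_natCast_dvd (Finsupp.mem_support_iff.1 hn)
  · rintro p ⟨hp, hper⟩
    rcases key p hp hper with ⟨n, hn, hdvd⟩ | hle
    · exact Or.inl (Set.mem_biUnion (Finsupp.mem_support_iff.2 hn) hdvd)
    · right
      rw [Set.mem_Iic]
      omega
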